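/- Let $p$ be a prime and let $k$ be a perfect field of characteristic $p$. For a commutative $k$-algebra $A$ let $\Omega^\bullet_{A/k}$ be its algebraic de Rham complex, and let $L\Omega^\bullet$ be the derived (not Hodge-completed) de Rham complex over $k$: the functor from animated commutative $k$-algebras to the derived $\infty$-category $\mathbf{D}(k)$ that is left Kan extended from polynomial $k$-algebras, where it is $A\mapsto\Omega^\bullet_{A/k}$. Concretely, for a simplicial commutative $k$-algebra $S$, $L\Omega^\bullet(S)$ is the geometric realization of $[n]\mapsto L\Omega^\bullet(S_n)$, and for an ordinary $k$-algebra $A$, $L\Omega^\bullet(A)$ is the geometric realization of $\Omega^\bullet_{P_\bullet/k}$, where $P_\bullet\to A$ is the standard resolution of $A$ by polynomial algebras; the geometric realization of a simplicial complex is its direct-sum total complex. Then the $\mathbb{A}^1$-localization of $L\Omega^\bullet$ vanishes, $L_{\mathbb{A}^1}L\Omega^\bullet\simeq 0$. Explicitly: 1. For every simplicial commutative $k$-algebra $S$, the complex $$(L_{\mathbb{A}^1}L\Omega^\bullet)(S)=\operatorname*{colim}_{[m]\in\Delta^{\mathrm{op}}}L\Omega^\bullet(S[\Delta^m]),\qquad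 S[\Delta^m]=S\otimes_k k[T_0,\dots,T_m]/(T_0+\cdots+T_m-1),$$ is acyclic (the colimit is a homotopy colimit, i.e. a geometric realization). 2. For every simplicial commutative $k$-algebra $R$, the map $L\Omega^\bullet\to 0$ exhibits $0$ as the reflection of $L\Omega^\bullet$ into $\mathbb{A}^1$-invariant presheaves, in the homotopy category (functors to complexes of $k$-modules with objectwise quasi-isomorphisms inverted) of functors from simplicial commutative $R$-algebras to $\mathbf{D}(k)$. Here a functor $G$ is called $\mathbb{A}^1$-invariant if it inverts weak equivalences (so that it is a presheaf on the opposite of animated $R$-algebras) and sends the canonical map $S\to S[t]$ to an equivalence for every $S$. That is, composition with $L\Omega^\bullet\to 0$ is a bijection $\operatorname{Hom}(0,G)\to\operatorname{Hom}(L\Omega^\bullet,G)$ for every such $G$. -/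

import Mathlib

open CategoryTheory
open scoped ZeroObject

universe v u

noncomputable section

namespace DeRham

section Forms

variable (k : Type u) [CommRing k] (A : Type u) [CommRing A] [Algebra k A]

/-- The graded algebra `⨁ₙ ⋀ⁿ_A Ω_{A/k}` of Kähler differential forms. -/
abbrev Forms : Type u := ExteriorAlgebra A (Ω[A⁄k])

variable {k A} in
/-- The exact one-form `da`. -/
def dOne (a : A) : Forms k A := ExteriorAlgebra.ι A (KaehlerDifferential.D k A a)

/-- The grade involution `ω ↦ (-1)^{|ω|} ω`. -/
abbrev sgn : Forms k A →ₐ[A] Forms k A := CliffordAlgebra.involute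

lemma sgn_dOne (a : A) : sgn k A (dOne a) = -dOne a := CliffordAlgebra.involute_ι _

lemma ι_mul_comm (m : Ω[A⁄k]) (x : Forms k A) :
    ExteriorAlgebra.ι A m * x = sgn k A x * ExteriorAlgebra.ι A m := by
  induction x using ExteriorAlgebra.induction with
  | algebraMap r => simp [(Algebra.commutes r _).symm]
  | ι x =>
    have h1 : sgn k A (ExteriorAlgebra.ι A x) = -ExteriorAlgebra.ι A x :=
      CliffordAlgebra.involute_ι _
    rw [h1, neg_mul]
    exact eq_neg_of_add_eq_zero_left (ExteriorAlgebra.ι_add_mul_swap m x)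
  | mul a b ha hb => rw [← mul_assoc, ha, mul_assoc, hb, map_mul, mul_assoc]
  | add a b ha hb => rw [mul_add, ha, hb, map_add, add_mul]

/-- The ring of pairs `(ω, η)` with `(ω, η)(ω', η') = (ωω', ηω' + (-1)^{|ω|} ωη')`: a map
`ω ↦ (ω, dω)` into it is multiplicative exactly when `d` is an antiderivation. -/
@[ext]
structure Pair where
  fst : Forms k A
  snd : Forms k A

namespace Pair

variable {k A}

instance : Zero (Pair k A) := ⟨⟨0, 0⟩⟩
instance : One (Pair k A) := ⟨⟨1, 0⟩⟩
instance : Add (Pair k A) := ⟨fun x y => ⟨x.fst + y.fst, x.snd + y.snd⟩⟩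
instance : Neg (Pair k A) := ⟨fun x => ⟨-x.fst, -x.snd⟩⟩
instance : Mul (Pair k A) :=
  ⟨fun x y => ⟨x.fst * y.fst, x.snd * y.fst + sgn k A x.fst * y.snd⟩⟩

@[simp] lemma zero_fst : (0 : Pair k A).fst = 0 := rfl
@[simp] lemma zero_snd : (0 : Pair k A).snd = 0 := rfl
@[simp] lemma one_fst : (1 : Pair k A).fst = 1 := rfl
@[simp] lemma one_snd : (1 : Pair k A).snd = 0 := rfl
@[simp] lemma add_fst (x y : Pair k A) : (x + y).fst = x.fst + y.fst := rfl
@[simp] lemma add_snd (x y : Pair k A) : (x + y).snd = x.snd + y.snd := rfl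
@[simp] lemma neg_fst (x : Pair k A) : (-x).fst = -x.fst := rfl
@[simp] lemma neg_snd (x : Pair k A) : (-x).snd = -x.snd := rfl
@[simp] lemma mul_fst (x y : Pair k A) : (x * y).fst = x.fst * y.fst := rfl
@[simp] lemma mul_snd (x y : Pair k A) :
    (x * y).snd = x.snd * y.fst + sgn k A x.fst * y.snd := rfl

instance : Ring (Pair k A) where
  add_assoc x y z := by ext <;> simp [add_assoc]
  zero_add x := by ext <;> simp
  add_zero x := by ext <;> simp
  add_comm x y := by ext <;> simp [add_comm]
  left_distrib x y z := by ext <;> simp only [add_fst, add_snd, mul_fst, mul_snd] <;> noncomm_ring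
  right_distrib x y z := by
    ext <;> simp only [add_fst, add_snd, mul_fst, mul_snd, map_add] <;> noncomm_ring
  zero_mul x := by ext <;> simp
  mul_zero x := by ext <;> simp
  mul_assoc x y z := by
    ext <;> simp only [mul_fst, mul_snd, map_mul] <;> noncomm_ring
  one_mul x := by ext <;> simp
  mul_one x := by ext <;> simp
  neg_add_cancel x := by ext <;> simp
  nsmul := nsmulRec
  zsmul := zsmulRec

/-- `a ↦ (a, da)`, which is central. -/
instance : Algebra A (Pair k A) :=
  RingHom.toAlgebra'
    { toFun := fun a => ⟨algebraMap A _ a, dOne a⟩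
      map_one' := by ext <;> simp [dOne]
      map_zero' := by ext <;> simp [dOne]
      map_add' := fun a b => by ext <;> simp [dOne]
      map_mul' := fun a b => by
        ext
        · simp
        · simp [dOne, Algebra.smul_def, Algebra.commutes, add_comm] }
    (fun a x => by
      ext
      · exact Algebra.commutes _ _
      · change dOne a * x.fst + sgn k A (algebraMap A _ a) * x.snd
          = x.snd * algebraMap A _ a + sgn k A x.fst * dOne a
        rw [AlgHom.commutes, Algebra.commutes, add_comm]
        congr 1
        exact ι_mul_comm k A _ _)

lemma algebraMap_fst (a : A) : (algebraMap A (Pair k A) a).fst = algebraMap A _ a := rfl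
lemma algebraMap_snd (a : A) : (algebraMap A (Pair k A) a).snd = dOne a := rfl

instance : Algebra k (Pair k A) := Algebra.compHom _ (algebraMap k A)

instance : IsScalarTower k A (Pair k A) := IsScalarTower.of_algebraMap_eq' rfl

lemma smul_fst (a : A) (x : Pair k A) : (a • x).fst = a • x.fst := by
  rw [Algebra.smul_def, mul_fst, algebraMap_fst, Algebra.smul_def]

lemma smul_snd (a : A) (x : Pair k A) : (a • x).snd = dOne a * x.fst + a • x.snd := by
  rw [Algebra.smul_def, mul_snd, algebraMap_snd, algebraMap_fst, AlgHom.commutes,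
    Algebra.smul_def]

end Pair

/-- The derivation `a ↦ (da, 0)`. -/
def pairDer : Derivation k A (Pair k A) :=
  Derivation.mk'
    { toFun := fun a => ⟨dOne a, 0⟩
      map_add' := fun a b => by ext <;> simp [dOne]
      map_smul' := fun c a => by
        rw [RingHom.id_apply]
        refine Eq.trans ?_ (algebraMap_smul A c (⟨dOne a, 0⟩ : Pair k A))
        ext
        · rw [Pair.smul_fst]; simp [dOne]
        · rw [Pair.smul_snd]; simp [dOne] }
    (fun a b => by
      ext
      · simp [Pair.smul_fst, dOne]
      · have := ExteriorAlgebra.ι_add_mul_swap (R := A) (KaehlerDifferential.D k A a)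
          (KaehlerDifferential.D k A b)
        simp [Pair.smul_snd, dOne, this])

/-- The `A`-linear map `ω ↦ (ω, dω)` on one-forms. -/
def pairOne : Ω[A⁄k] →ₗ[A] Pair k A := (pairDer k A).liftKaehlerDifferential

lemma pairOne_D (a : A) : pairOne k A (KaehlerDifferential.D k A a) = ⟨dOne a, 0⟩ :=
  Derivation.liftKaehlerDifferential_comp_D _ a

variable {k A} in
lemma omega_induction {P : Ω[A⁄k] → Prop} (h0 : P 0) (hD : ∀ a, P (KaehlerDifferential.D k A a))
    (hadd : ∀ x y, P x → P y → P (x + y)) (hsmul : ∀ (a : A) x, P x → P (a • x)) (x) : P x := by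
  have hx : x ∈ Submodule.span A (Set.range (KaehlerDifferential.D k A)) := by
    rw [KaehlerDifferential.span_range_derivation]; trivial
  induction hx using Submodule.span_induction with
  | mem x h => obtain ⟨a, rfl⟩ := h; exact hD a
  | zero => exact h0
  | add x y _ _ hx hy => exact hadd x y hx hy
  | smul a x _ hx => exact hsmul a x hx

lemma pairOne_fst (m : Ω[A⁄k]) : (pairOne k A m).fst = ExteriorAlgebra.ι A m := by
  induction m using omega_induction with
  | h0 => simp
  | hD a => rw [pairOne_D]; rfl
  | hadd x y hx hy => simp [hx, hy]
  | hsmul a x hx => simp [Pair.smul_fst, hx]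

lemma sgn_pairOne_snd (m : Ω[A⁄k]) : sgn k A (pairOne k A m).snd = (pairOne k A m).snd := by
  induction m using omega_induction with
  | h0 => simp
  | hD a => simp [pairOne_D]
  | hadd x y hx hy => simp only [map_add, Pair.add_snd, hx, hy]
  | hsmul a x hx =>
    simp only [map_smul, map_add, map_mul, Pair.smul_snd, hx, pairOne_fst, sgn_dOne]
    congr 1
    rw [show sgn k A (ExteriorAlgebra.ι A x) = -ExteriorAlgebra.ι A x from
      CliffordAlgebra.involute_ι _, neg_mul_neg]

lemma pairOne_sq (m : Ω[A⁄k]) : pairOne k A m * pairOne k A m = 0 := by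
  ext
  · simp [pairOne_fst]
  · simp only [Pair.mul_snd, pairOne_fst, Pair.zero_snd]
    rw [show sgn k A (ExteriorAlgebra.ι A m) = -ExteriorAlgebra.ι A m from
      CliffordAlgebra.involute_ι _, neg_mul, ι_mul_comm, sgn_pairOne_snd, add_neg_cancel]

/-- The algebra homomorphism `ω ↦ (ω, dω)`. -/
def pairHom : Forms k A →ₐ[A] Pair k A :=
  ExteriorAlgebra.lift A ⟨pairOne k A, pairOne_sq k A⟩

lemma pairHom_ι (m : Ω[A⁄k]) : pairHom k A (ExteriorAlgebra.ι A m) = pairOne k A m :=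
  ExteriorAlgebra.lift_ι_apply _ _ _ _

lemma pairHom_fst (x : Forms k A) : (pairHom k A x).fst = x := by
  induction x using ExteriorAlgebra.induction with
  | algebraMap r => rw [AlgHom.commutes]; rfl
  | ι x => rw [pairHom_ι, pairOne_fst]
  | mul a b ha hb => rw [map_mul, Pair.mul_fst, ha, hb]
  | add a b ha hb => rw [map_add, Pair.add_fst, ha, hb]

/-- The exterior derivative, characterised by `extD_algebraMap`, `extD_dOne` and `extD_mul`. -/
def extD : Forms k A →ₗ[k] Forms k A where
  toFun x := (pairHom k A x).snd
  map_add' x y := by simp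
  map_smul' c x := by
    rw [RingHom.id_apply, ← algebraMap_smul A c x, map_smul, Pair.smul_snd]
    simp [dOne]

lemma extD_algebraMap (a : A) : extD k A (algebraMap A _ a) = dOne a := by
  change (pairHom k A _).snd = _
  rw [AlgHom.commutes]; rfl

lemma extD_dOne (a : A) : extD k A (dOne a) = 0 := by
  change (pairHom k A _).snd = _
  rw [dOne, pairHom_ι, pairOne_D]

lemma extD_mul (x y : Forms k A) :
    extD k A (x * y) = extD k A x * y + sgn k A x * extD k A y := by
  change (pairHom k A _).snd = _
  rw [map_mul, Pair.mul_snd, pairHom_fst, pairHom_fst]; rfl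

variable {k A} in
/-- Forms are generated by functions and exact one-forms. -/
lemma forms_induction {P : Forms k A → Prop} (hA : ∀ a, P (algebraMap A _ a))
    (hD : ∀ a, P (dOne a)) (hadd : ∀ x y, P x → P y → P (x + y))
    (hmul : ∀ x y, P x → P y → P (x * y)) (x) : P x := by
  induction x using ExteriorAlgebra.induction with
  | algebraMap r => exact hA r
  | ι m =>
    induction m using omega_induction with
    | h0 => simpa using hA 0
    | hD a => exact hD a
    | hadd x y hx hy => rw [map_add]; exact hadd _ _ hx hy
    | hsmul a x hx => rw [map_smul, Algebra.smul_def]; exact hmul _ _ (hA a) hx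
  | mul a b ha hb => exact hmul _ _ ha hb
  | add a b ha hb => exact hadd _ _ ha hb

lemma extD_sgn (x : Forms k A) : extD k A (sgn k A x) = -sgn k A (extD k A x) := by
  induction x using forms_induction with
  | hA a => simp only [AlgHom.commutes, extD_algebraMap, sgn_dOne, neg_neg]
  | hD a => simp only [sgn_dOne, map_neg, extD_dOne, map_zero]
  | hadd x y hx hy => simp only [map_add, hx, hy, neg_add]
  | hmul x y hx hy =>
    simp only [map_mul, extD_mul, map_add, hx, hy]
    noncomm_ring

lemma extD_extD (x : Forms k A) : extD k A (extD k A x) = 0 := by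
  induction x using forms_induction with
  | hA a => rw [extD_algebraMap, extD_dOne]
  | hD a => rw [extD_dOne, map_zero]
  | hadd x y hx hy => simp only [map_add, hx, hy, add_zero]
  | hmul x y hx hy =>
    simp only [map_add, extD_mul, hx, hy, extD_sgn, zero_mul, mul_zero, add_zero, zero_add,
      neg_mul, add_neg_cancel]

lemma extD_mem (n : ℕ) (x : Forms k A) (hx : x ∈ ⋀[A]^n (Ω[A⁄k])) :
    extD k A x ∈ ⋀[A]^(n + 1) (Ω[A⁄k]) := by
  have h1 : ∀ a : A, (dOne a : Forms k A) ∈ LinearMap.range (ExteriorAlgebra.ι A (M := Ω[A⁄k])) :=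
    fun a => ⟨_, rfl⟩
  have h2 : ∀ m : Ω[A⁄k], extD k A (ExteriorAlgebra.ι A m) ∈ ⋀[A]^2 (Ω[A⁄k]) := by
    intro m
    induction m using omega_induction with
    | h0 => simp
    | hD a => rw [show ExteriorAlgebra.ι A (KaehlerDifferential.D k A a) = dOne a from rfl,
        extD_dOne]; exact Submodule.zero_mem _
    | hadd x y hx hy => rw [map_add, map_add]; exact Submodule.add_mem _ hx hy
    | hsmul a x hx =>
      rw [map_smul, Algebra.smul_def, extD_mul, extD_algebraMap, AlgHom.commutes,
        ← Algebra.smul_def]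
      refine Submodule.add_mem _ ?_ (Submodule.smul_mem _ _ hx)
      rw [ExteriorAlgebra.exteriorPower, pow_two]
      exact Submodule.mul_mem_mul (h1 a) ⟨x, rfl⟩
  induction n generalizing x with
  | zero =>
    rw [ExteriorAlgebra.exteriorPower, pow_zero, Submodule.mem_one] at hx
    obtain ⟨a, rfl⟩ := hx
    rw [extD_algebraMap, ExteriorAlgebra.exteriorPower, zero_add, pow_one]
    exact h1 a
  | succ n ih =>
    rw [ExteriorAlgebra.exteriorPower, pow_succ'] at hx
    refine Submodule.mul_induction_on hx ?_ ?_
    · intro y hy z hz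
      obtain ⟨m, rfl⟩ := hy
      rw [extD_mul]
      refine Submodule.add_mem _ ?_ ?_
      · rw [ExteriorAlgebra.exteriorPower, show n + 1 + 1 = 2 + n by omega, pow_add]
        exact Submodule.mul_mem_mul (h2 m) hz
      · rw [ExteriorAlgebra.exteriorPower, pow_succ',
          show sgn k A (ExteriorAlgebra.ι A m) = -ExteriorAlgebra.ι A m from
            CliffordAlgebra.involute_ι _]
        exact Submodule.mul_mem_mul (Submodule.neg_mem _ ⟨m, rfl⟩) (ih z hz)
    · intro y z hy hz
      rw [map_add]; exact Submodule.add_mem _ hy hz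

/-- The exterior derivative `⋀ⁿ Ω_{A/k} → ⋀ⁿ⁺¹ Ω_{A/k}`. -/
def extDeg (n : ℕ) : ⋀[A]^n (Ω[A⁄k]) →ₗ[k] ⋀[A]^(n + 1) (Ω[A⁄k]) where
  toFun x := ⟨extD k A x.1, extD_mem k A n x.1 x.2⟩
  map_add' x y := Subtype.ext (map_add (extD k A) x.1 y.1)
  map_smul' c x := Subtype.ext (map_smul (extD k A) c x.1)

/-- The de Rham complex `A → Ω¹ → Ω² → ⋯` of a `k`-algebra. -/
def complexNat : CochainComplex (ModuleCat.{u} k) ℕ :=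
  CochainComplex.of (fun n => ModuleCat.of k (⋀[A]^n (Ω[A⁄k])))
    (fun n => ModuleCat.ofHom (extDeg k A n))
    (fun n => by
      ext x
      exact extD_extD k A x.1)

lemma complexNat_d (n : ℕ) :
    (complexNat k A).d n (n + 1) = ModuleCat.ofHom (extDeg k A n) :=
  CochainComplex.of_d (fun n => ModuleCat.of k (⋀[A]^n (Ω[A⁄k])))
    (fun n => ModuleCat.ofHom (extDeg k A n)) n

end Forms

section Functoriality

variable {k : Type u} [CommRing k] {A B C : Type u} [CommRing A] [Algebra k A]
  [CommRing B] [Algebra k B] [CommRing C] [Algebra k C]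

/-- The pullback of forms along `f : A → B`, characterised by `formsMap_algebraMap` and
`formsMap_dOne`. -/
def formsMap (f : A →ₐ[k] B) : Forms k A →ₐ[k] Forms k B :=
  letI : Algebra A (Forms k B) := RingHom.toAlgebra' ((algebraMap B (Forms k B)).comp f.toRingHom)
    (fun a x => Algebra.commutes (f a) x)
  haveI : IsScalarTower k A (Forms k B) := IsScalarTower.of_algebraMap_eq (fun x => by
    change algebraMap k (Forms k B) x = algebraMap B (Forms k B) (f (algebraMap k A x))
    rw [f.commutes, ← IsScalarTower.algebraMap_apply])
  let D : Derivation k A (Forms k B) :=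
    Derivation.mk' (((ExteriorAlgebra.ι B (M := Ω[B⁄k])).restrictScalars k).comp
      ((KaehlerDifferential.D k B).toLinearMap.comp f.toLinearMap)) (fun a b => by
        change dOne (f (a * b)) = a • dOne (f b) + b • dOne (f a)
        rw [Algebra.smul_def, Algebra.smul_def]
        change dOne (f (a * b)) = algebraMap B (Forms k B) (f a) * dOne (f b) +
          algebraMap B (Forms k B) (f b) * dOne (f a)
        simp [dOne, Algebra.smul_def])
  have hD : ∀ m, D.liftKaehlerDifferential m ∈
      LinearMap.range (ExteriorAlgebra.ι B (M := Ω[B⁄k])) := fun m => by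
    induction m using omega_induction with
    | h0 => rw [map_zero]; exact Submodule.zero_mem _
    | hD a => rw [Derivation.liftKaehlerDifferential_comp_D]; exact ⟨_, rfl⟩
    | hadd x y hx hy => rw [map_add]; exact Submodule.add_mem _ hx hy
    | hsmul a x hx =>
      rw [map_smul, Algebra.smul_def]
      change algebraMap B (Forms k B) (f a) * _ ∈ _
      rw [← Algebra.smul_def]
      exact Submodule.smul_mem _ _ hx
  (ExteriorAlgebra.lift A ⟨D.liftKaehlerDifferential, fun m => by
    obtain ⟨x, hx⟩ := hD m
    rw [← hx, ExteriorAlgebra.ι_sq_zero]⟩).restrictScalars k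

lemma formsMap_algebraMap (f : A →ₐ[k] B) (a : A) :
    formsMap f (algebraMap A _ a) = algebraMap B _ (f a) := by
  let : Algebra A (Forms k B) := RingHom.toAlgebra' ((algebraMap B (Forms k B)).comp f.toRingHom)
    (fun a x => Algebra.commutes (f a) x)
  exact AlgHom.commutes (R := A) (B := Forms k B) _ a

lemma formsMap_dOne (f : A →ₐ[k] B) (a : A) :
    formsMap f (dOne a) = dOne (f a) := by
  let : Algebra A (Forms k B) := RingHom.toAlgebra' ((algebraMap B (Forms k B)).comp f.toRingHom)
    (fun a x => Algebra.commutes (f a) x)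
  have : IsScalarTower k A (Forms k B) := IsScalarTower.of_algebraMap_eq (fun x => by
    change algebraMap k (Forms k B) x = algebraMap B (Forms k B) (f (algebraMap k A x))
    rw [f.commutes, ← IsScalarTower.algebraMap_apply])
  refine (ExteriorAlgebra.lift_ι_apply A (A := Forms k B) _ _ _).trans ?_
  exact Derivation.liftKaehlerDifferential_comp_D _ _

lemma formsMap_id (x : Forms k A) : formsMap (AlgHom.id k A) x = x := by
  induction x using forms_induction with
  | hA a => rw [formsMap_algebraMap]; rfl
  | hD a => rw [formsMap_dOne]; rfl
  | hadd x y hx hy => rw [map_add, hx, hy]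
  | hmul x y hx hy => rw [map_mul, hx, hy]

lemma formsMap_comp (f : A →ₐ[k] B) (g : B →ₐ[k] C) (x : Forms k A) :
    formsMap (g.comp f) x = formsMap g (formsMap f x) := by
  induction x using forms_induction with
  | hA a => simp only [formsMap_algebraMap, AlgHom.comp_apply]
  | hD a => simp only [formsMap_dOne, AlgHom.comp_apply]
  | hadd x y hx hy => simp only [map_add, hx, hy]
  | hmul x y hx hy => simp only [map_mul, hx, hy]

lemma formsMap_sgn (f : A →ₐ[k] B) (x : Forms k A) :
    formsMap f (sgn k A x) = sgn k B (formsMap f x) := by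
  induction x using forms_induction with
  | hA a => simp only [formsMap_algebraMap, AlgHom.commutes]
  | hD a => simp only [formsMap_dOne, sgn_dOne, map_neg]
  | hadd x y hx hy => simp only [map_add, hx, hy]
  | hmul x y hx hy => simp only [map_mul, hx, hy]

lemma formsMap_extD (f : A →ₐ[k] B) (x : Forms k A) :
    formsMap f (extD k A x) = extD k B (formsMap f x) := by
  induction x using forms_induction with
  | hA a => simp only [formsMap_algebraMap, extD_algebraMap, formsMap_dOne]
  | hD a => simp only [formsMap_dOne, extD_dOne, map_zero]
  | hadd x y hx hy => simp only [map_add, hx, hy]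
  | hmul x y hx hy => simp only [map_mul, map_add, extD_mul, hx, hy, formsMap_sgn]

lemma formsMap_mem (f : A →ₐ[k] B) (n : ℕ) (x : Forms k A) (hx : x ∈ ⋀[A]^n (Ω[A⁄k])) :
    formsMap f x ∈ ⋀[B]^n (Ω[B⁄k]) := by
  have h : ∀ m : Ω[A⁄k], formsMap f (ExteriorAlgebra.ι A m) ∈
      LinearMap.range (ExteriorAlgebra.ι B (M := Ω[B⁄k])) := by
    intro m
    induction m using omega_induction with
    | h0 => simp
    | hD a =>
      rw [show ExteriorAlgebra.ι A (KaehlerDifferential.D k A a) = dOne a from rfl, formsMap_dOne]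
      exact ⟨_, rfl⟩
    | hadd x y hx hy => rw [map_add, map_add]; exact Submodule.add_mem _ hx hy
    | hsmul a x hx =>
      rw [map_smul, Algebra.smul_def, map_mul, formsMap_algebraMap, ← Algebra.smul_def]
      exact Submodule.smul_mem _ _ hx
  induction n generalizing x with
  | zero =>
    rw [ExteriorAlgebra.exteriorPower, pow_zero, Submodule.mem_one] at hx ⊢
    obtain ⟨a, rfl⟩ := hx
    exact ⟨f a, (formsMap_algebraMap f a).symm⟩
  | succ n ih =>
    rw [ExteriorAlgebra.exteriorPower, pow_succ'] at hx ⊢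
    refine Submodule.mul_induction_on hx ?_ ?_
    · intro y hy z hz
      obtain ⟨m, rfl⟩ := hy
      rw [map_mul]
      exact Submodule.mul_mem_mul (h m) (ih z hz)
    · intro y z hy hz
      rw [map_add]; exact Submodule.add_mem _ hy hz

/-- The pullback of `n`-forms along `f : A → B`. -/
def formsMapDeg (f : A →ₐ[k] B) (n : ℕ) : ⋀[A]^n (Ω[A⁄k]) →ₗ[k] ⋀[B]^n (Ω[B⁄k]) where
  toFun x := ⟨formsMap f x.1, formsMap_mem f n x.1 x.2⟩
  map_add' x y := Subtype.ext (map_add (formsMap f) x.1 y.1)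
  map_smul' c x := Subtype.ext (map_smul (formsMap f) c x.1)

end Functoriality

/-- The de Rham complex `A ↦ Ω^•_{A/k}`, as a functor. -/
def functorNat (k : Type u) [CommRing k] :
    CommAlgCat.{u} k ⥤ CochainComplex (ModuleCat.{u} k) ℕ where
  obj A := complexNat k A
  map {A B} f := CochainComplex.ofHom
    (fun n => ModuleCat.ofHom (formsMapDeg f.hom n))
    (fun n => by
      rw [complexNat_d, complexNat_d]
      ext x
      refine Subtype.ext ?_
      exact (formsMap_extD f.hom x.1).symm)
  map_id A := by
    ext n x
    exact Subtype.ext (formsMap_id x.1)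
  map_comp f g := by
    ext n x
    exact Subtype.ext (formsMap_comp f.hom g.hom x.1)

/-- The de Rham complex `A ↦ Ω^•_{A/k}`, with cohomological degrees in `ℤ`. -/
def functor (k : Type u) [CommRing k] :
    CommAlgCat.{u} k ⥤ CochainComplex (ModuleCat.{u} k) ℤ :=
  functorNat k ⋙ ComplexShape.embeddingUpNat.extendFunctor _

end DeRham

namespace A1Loc

section Bar

variable {C : Type u} [Category.{v} C] (G : Comonad C)

/-- The iterate `G (G (⋯ (G X)))`, with `n` copies of `G`. -/
@[reducible]
def iterObj (X : C) : ℕ → C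
  | 0 => X
  | n + 1 => G.obj (iterObj X n)

def iterMap {X Y : C} (f : X ⟶ Y) : (n : ℕ) → (iterObj G X n ⟶ iterObj G Y n)
  | 0 => f
  | n + 1 => G.map (iterMap f n)

lemma iterMap_id (X : C) (n : ℕ) : iterMap G (𝟙 X) n = 𝟙 _ := by
  induction n with
  | zero => rfl
  | succ n ih => rw [iterMap, ih]; exact G.map_id _

lemma iterMap_comp {X Y Z : C} (f : X ⟶ Y) (g : Y ⟶ Z) (n : ℕ) :
    iterMap G (f ≫ g) n = iterMap G f n ≫ iterMap G g n := by
  induction n with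
  | zero => rfl
  | succ n ih => rw [iterMap, ih]; exact G.map_comp _ _

/-- `α` without the source point `0`. -/
def dropSource {m n : ℕ} (α : Fin (m + 1) →o Fin n) : Fin m →o Fin n :=
  ⟨fun i => α i.succ, fun _ _ h => α.monotone (Fin.succ_le_succ_iff.mpr h)⟩

lemma ne_zero_of_zero {m n : ℕ} (α : Fin (m + 1) →o Fin (n + 1)) (h : α 0 ≠ 0) (i) : α i ≠ 0 :=
  fun hi => h (le_antisymm (hi ▸ α.monotone (Fin.zero_le i)) (Fin.zero_le _))

/-- `α` without the target point `0`, which it misses. -/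
def dropTarget {m n : ℕ} (α : Fin m →o Fin (n + 1)) (h : ∀ i, α i ≠ 0) : Fin m →o Fin n :=
  ⟨fun i => (α i).pred (h i), fun _ _ hij => Fin.pred_le_pred_iff.mpr (α.monotone hij)⟩

/-- The action of an order-preserving map on the iterates of a comonad: the copy of `G` at
`j` is replaced by as many copies as there are points above `j`, through the counit if there are
none and through the iterated comultiplication otherwise. -/
def iterAct (X : C) : (n m : ℕ) → (Fin m →o Fin n) → (iterObj G X n ⟶ iterObj G X m)
  | 0, 0, _ => 𝟙 _
  | 0, _ + 1, α => (α 0).elim0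
  | n + 1, 0, _ => G.ε.app _ ≫ iterAct X n 0 ⟨Fin.elim0, fun i => i.elim0⟩
  | n + 1, m + 1, α =>
    if h : α 0 = 0 then
      G.δ.app _ ≫ G.map (iterAct X (n + 1) m (dropSource α))
    else
      G.ε.app _ ≫ iterAct X n (m + 1) (dropTarget α (ne_zero_of_zero α h))

lemma iterAct_skip (X : C) (n m : ℕ) (α : Fin m →o Fin (n + 1)) (h : ∀ i, α i ≠ 0) :
    iterAct G X (n + 1) m α = G.ε.app _ ≫ iterAct G X n m (dropTarget α h) := by
  cases m with
  | zero => rw [iterAct]; congr 2; ext i; exact i.elim0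
  | succ m => rw [iterAct, dif_neg (h 0)]

lemma iterAct_hit (X : C) (n m : ℕ) (α : Fin (m + 1) →o Fin (n + 1)) (h : α 0 = 0) :
    iterAct G X (n + 1) (m + 1) α =
      G.δ.app _ ≫ G.map (iterAct G X (n + 1) m (dropSource α)) := by
  rw [iterAct, dif_pos h]

lemma iterAct_id (X : C) (n : ℕ) : iterAct G X n n OrderHom.id = 𝟙 _ := by
  induction n with
  | zero => rw [iterAct]
  | succ n ih =>
    rw [iterAct_hit _ _ _ _ _ rfl, iterAct_skip _ _ _ _ _ (fun i => Fin.succ_ne_zero i)]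
    have : dropTarget (dropSource (OrderHom.id : Fin (n + 1) →o Fin (n + 1)))
        (fun i => Fin.succ_ne_zero i) = OrderHom.id := by
      ext i; simp [dropTarget, dropSource]
    rw [this, ih]
    exact (congrArg (fun f => G.δ.app _ ≫ G.map f) (Category.comp_id _)).trans (G.right_counit _)

lemma iterAct_comp (X : C) : ∀ (l n m : ℕ) (β : Fin n →o Fin l) (α : Fin m →o Fin n),
    iterAct G X l m (β.comp α) = iterAct G X l n β ≫ iterAct G X n m α
  | 0, 0, 0, β, α => by simp [iterAct]
  | 0, _ + 1, _, β, α => (β 0).elim0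
  | _, 0, _ + 1, β, α => (α 0).elim0
  | l + 1, 0, 0, β, α => by
    rw [iterAct_skip G X l 0 _ (fun i => i.elim0), iterAct_skip G X l 0 β (fun i => i.elim0),
      Category.assoc, ← iterAct_comp X l 0 0]
    rfl
  | l + 1, n + 1, m, β, α => by
    by_cases hβ : β 0 = 0
    · rw [iterAct_hit G X l n β hβ]
      by_cases hα : ∀ i, α i ≠ 0
      · rw [iterAct_skip G X n m α hα, Category.assoc, G.counit_naturality_assoc,
          G.left_counit_assoc, ← iterAct_comp X (l + 1) n m]
        congr 1
        ext i
        change _ = ((β ((α i).pred (hα i)).succ : Fin (l + 1)) : ℕ)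
        rw [Fin.succ_pred]
        rfl
      · cases m with
        | zero => exact absurd (fun i => i.elim0) hα
        | succ m =>
          have h0 : α 0 = 0 := by
            by_contra h
            exact hα (ne_zero_of_zero α h)
          rw [iterAct_hit G X n m α h0, iterAct_hit G X l m _ (by simp [h0, hβ]),
            show dropSource (β.comp α) = β.comp (dropSource α) from rfl,
            iterAct_comp X (l + 1) (n + 1) m, iterAct_hit G X l n β hβ]
          simp only [Functor.map_comp, Category.assoc]
          rw [G.coassoc_assoc, G.delta_naturality_assoc]
    · have hβ' := ne_zero_of_zero β hβ
      rw [iterAct_skip G X l (n + 1) β hβ', iterAct_skip G X l m _ (fun i => show (β.comp α) i ≠ 0 from hβ' (α i)),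
        Category.assoc, ← iterAct_comp X l (n + 1) m]
      rfl
  termination_by l n m => (l, m, n)

lemma iterAct_naturality {X Y : C} (f : X ⟶ Y) : ∀ (n m : ℕ) (α : Fin m →o Fin n),
    iterMap G f n ≫ iterAct G Y n m α = iterAct G X n m α ≫ iterMap G f m
  | 0, 0, _ => by simp [iterAct, iterMap]
  | 0, _ + 1, α => (α 0).elim0
  | n + 1, 0, α => by
    rw [iterAct_skip G Y n 0 _ (fun i => i.elim0), iterAct_skip G X n 0 _ (fun i => i.elim0),
      Category.assoc, ← iterAct_naturality f n 0, iterMap, G.counit_naturality_assoc]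
  | n + 1, m + 1, α => by
    by_cases h : α 0 = 0
    · rw [iterAct_hit G Y n m α h, iterAct_hit G X n m α h, Category.assoc]
      conv_lhs => rw [iterMap]
      conv_rhs => rw [iterMap]
      rw [← Functor.map_comp, ← iterAct_naturality f (n + 1) m, Functor.map_comp,
        G.delta_naturality_assoc]
      rfl
    · have h' := ne_zero_of_zero α h
      rw [iterAct_skip G Y n _ _ h', iterAct_skip G X n _ _ h',
        Category.assoc, ← iterAct_naturality f n (m + 1), iterMap, G.counit_naturality_assoc]

/-- The bar construction `[n] ↦ Gⁿ⁺¹ X` of a comonad. -/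
def bar : C ⥤ SimplicialObject C where
  obj X :=
    { obj := fun n => iterObj G X (n.unop.len + 1)
      map := fun α => iterAct G X _ _ α.unop.toOrderHom
      map_id := fun n => iterAct_id G X _
      map_comp := fun α β => iterAct_comp G X _ _ _ α.unop.toOrderHom β.unop.toOrderHom }
  map f :=
    { app := fun n => iterMap G f _
      naturality := fun _ _ α => (iterAct_naturality G f _ _ α.unop.toOrderHom).symm }
  map_id X := by ext n; exact iterMap_id G X _
  map_comp f g := by ext n; exact iterMap_comp G f g _

end Bar

/-- The comonad `A ↦ k[A]` on commutative `k`-algebras, with `k[A]` the polynomial algebra on the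
underlying set of `A`. -/
def polyComonad (k : Type u) [CommRing k] : Comonad (CommAlgCat.{u} k) where
  obj A := CommAlgCat.of k (MvPolynomial A k)
  map f := CommAlgCat.ofHom (MvPolynomial.rename f.hom)
  map_id A := by ext x; simp
  map_comp f g := by ext x; simp
  ε :=
    { app := fun A => CommAlgCat.ofHom (MvPolynomial.aeval id)
      naturality := fun A B f => by
        ext : 1
        apply MvPolynomial.algHom_ext
        intro a; simp }
  δ :=
    { app := fun A => CommAlgCat.ofHom (MvPolynomial.rename MvPolynomial.X)
      naturality := fun A B f => by
        ext : 1
        apply MvPolynomial.algHom_ext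
        intro a; simp }
  coassoc A := by
    ext : 1
    apply MvPolynomial.algHom_ext
    intro a; simp
  left_counit A := by
    ext : 1
    apply MvPolynomial.algHom_ext
    intro a
    change MvPolynomial.aeval id (MvPolynomial.rename MvPolynomial.X (MvPolynomial.X a)) =
      MvPolynomial.X a
    rw [MvPolynomial.rename_X, MvPolynomial.aeval_X, id]
  right_counit A := by
    ext : 1
    apply MvPolynomial.algHom_ext
    intro a; simp

/-- The geometric realization (homotopy colimit over `Δᵒᵖ`) of a simplicial complex of modules:
the direct-sum total complex of its alternating face map complex. -/
def realization (k : Type u) [CommRing k] :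
    SimplicialObject (CochainComplex (ModuleCat.{u} k) ℤ) ⥤ CochainComplex (ModuleCat.{u} k) ℤ :=
  AlgebraicTopology.alternatingFaceMapComplex _ ⋙
    ComplexShape.embeddingDownNat.extendFunctor _ ⋙
    HomologicalComplex₂.totalFunctor (ModuleCat.{u} k) (ComplexShape.up ℤ) (ComplexShape.up ℤ)
      (ComplexShape.up ℤ)

/-- The derived de Rham complex of a `k`-algebra: the realization of the de Rham complexes of the
terms of its standard polynomial resolution (the value at a discrete algebra of the left Kan
extension of `A ↦ Ω^•_{A/k}` from polynomial algebras; it is not Hodge-completed). -/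
def derivedDeRhamDiscrete (k : Type u) [CommRing k] :
    CommAlgCat.{u} k ⥤ CochainComplex (ModuleCat.{u} k) ℤ :=
  bar (polyComonad k) ⋙ (SimplicialObject.whiskering _ _).obj (DeRham.functor k) ⋙ realization k

/-- Simplicial commutative `k`-algebras. -/
abbrev SCAlg (k : Type u) [CommRing k] := SimplicialObject (CommAlgCat.{u} k)

/-- The derived de Rham complex of a simplicial commutative `k`-algebra `S`: the realization of
`[n] ↦ LΩ(S_n)`, since the left Kan extension commutes with sifted colimits. -/
def derivedDeRham (k : Type u) [CommRing k] :
    SCAlg k ⥤ CochainComplex (ModuleCat.{u} k) ℤ :=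
  (SimplicialObject.whiskering _ _).obj (derivedDeRhamDiscrete k) ⋙ realization k

section AffineSimplex

variable (k : Type u) [CommRing k]

/-- The coordinate ring `k[T₀, …, Tₙ] / (T₀ + ⋯ + Tₙ - 1)` of the affine `n`-simplex. -/
abbrev SimplexRing (n : ℕ) : Type u :=
  MvPolynomial (Fin (n + 1)) k ⧸
    Ideal.span {(∑ i : Fin (n + 1), MvPolynomial.X i - 1 : MvPolynomial (Fin (n + 1)) k)}

/-- The coordinate `Tᵢ`. -/
def coord (n : ℕ) (i : Fin (n + 1)) : SimplexRing k n := Ideal.Quotient.mk _ (MvPolynomial.X i)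

lemma sum_coord (n : ℕ) : ∑ i, coord k n i = 1 := by
  simp only [coord]
  rw [← map_sum, ← map_one (Ideal.Quotient.mk _), Ideal.Quotient.eq]
  exact Ideal.subset_span rfl

variable {k} in
/-- The map `T_j ↦ ∑_{g i = j} T_i`. -/
def simplexRingMap {l m : ℕ} (g : Fin (m + 1) → Fin (l + 1)) :
    SimplexRing k l →ₐ[k] SimplexRing k m :=
  Ideal.Quotient.liftₐ _ (MvPolynomial.aeval (fun j => ∑ i with g i = j, coord k m i)) (by
    intro a ha
    rw [← RingHom.mem_ker]
    refine (Ideal.span_le (I := RingHom.ker (MvPolynomial.aeval _ : _ →ₐ[k] _))).mpr ?_ ha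
    rw [Set.singleton_subset_iff]
    simp only [SetLike.mem_coe, RingHom.mem_ker, map_sub, map_sum, MvPolynomial.aeval_X, map_one]
    rw [Finset.sum_fiberwise, sum_coord, sub_self])

variable {k} in
lemma simplexRingMap_coord {l m : ℕ} (g : Fin (m + 1) → Fin (l + 1)) (j : Fin (l + 1)) :
    simplexRingMap g (coord k l j) = ∑ i with g i = j, coord k m i :=
  MvPolynomial.aeval_X _ _

variable {k} in
lemma simplexRing_hom_ext {n : ℕ} {B : Type u} [CommRing B] [Algebra k B]
    {f g : SimplexRing k n →ₐ[k] B} (h : ∀ i, f (coord k n i) = g (coord k n i)) : f = g := by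
  apply Ideal.Quotient.algHom_ext
  exact MvPolynomial.algHom_ext h

/-- The standard affine simplex `k[Δ^•]`. -/
def affineSimplex : SimplicialObject (CommAlgCat.{u} k) where
  obj n := CommAlgCat.of k (SimplexRing k n.unop.len)
  map α := CommAlgCat.ofHom (simplexRingMap α.unop.toOrderHom)
  map_id n := by
    ext : 1
    refine simplexRing_hom_ext fun j => (simplexRingMap_coord _ j).trans ?_
    simp [Finset.filter_eq']
  map_comp {l m n} α β := by
    ext : 1
    refine simplexRing_hom_ext fun j => (simplexRingMap_coord _ j).trans ?_
    refine Eq.trans ?_ (congrArg (simplexRingMap β.unop.toOrderHom)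
      (simplexRingMap_coord α.unop.toOrderHom j)).symm
    rw [map_sum]
    simp only [simplexRingMap_coord]
    rw [Finset.sum_fiberwise_eq_sum_filter]
    refine Finset.sum_congr ?_ fun _ _ => rfl
    ext i
    simp

end AffineSimplex

/-- The bifunctor `(B, A) ↦ A ⊗ B` on commutative `k`-algebras. -/
def tensorFunctor (k : Type u) [CommRing k] :
    CommAlgCat.{u} k ⥤ CommAlgCat.{u} k ⥤ CommAlgCat.{u} k where
  obj B :=
    { obj := fun A => CommAlgCat.of k (TensorProduct k A B)
      map := fun f => CommAlgCat.ofHom (Algebra.TensorProduct.map f.hom (AlgHom.id k B))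
      map_id := fun A => by ext : 1; exact Algebra.TensorProduct.map_id
      map_comp := fun f g => by
        ext : 1
        apply Algebra.TensorProduct.ext'
        intro a b; simp }
  map g :=
    { app := fun A => CommAlgCat.ofHom (Algebra.TensorProduct.map (AlgHom.id k A) g.hom)
      naturality := fun A A' f => by
        ext : 1
        apply Algebra.TensorProduct.ext'
        intro a b; simp }
  map_id B := by
    ext A : 3
    exact Algebra.TensorProduct.map_id
  map_comp f g := by
    ext A : 3
    apply Algebra.TensorProduct.ext'
    intro a b; simp

/-- The functor `S ↦ S[Δ^•] = S ⊗ k[Δ^•]`, valued in simplicial objects in simplicial commutative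
`k`-algebras. -/
def simplexExt (k : Type u) [CommRing k] : SCAlg k ⥤ SimplicialObject (SCAlg k) :=
  (affineSimplex k ⋙ tensorFunctor k ⋙ SimplicialObject.whiskering _ _).flip

/-- The `𝔸¹`-localization of `F` by the formula `S ↦ colim_{[m] ∈ Δᵒᵖ} F(S[Δ^m])`. -/
def suslin (k : Type u) [CommRing k] (F : SCAlg k ⥤ CochainComplex (ModuleCat.{u} k) ℤ) :
    SCAlg k ⥤ CochainComplex (ModuleCat.{u} k) ℤ :=
  simplexExt k ⋙ (SimplicialObject.whiskering _ _).obj F ⋙ realization k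

/-- The functor `A ↦ A[t]`. -/
def polyExt (k : Type u) [CommRing k] : CommAlgCat.{u} k ⥤ CommAlgCat.{u} k where
  obj A := CommAlgCat.of k (Polynomial A)
  map f := CommAlgCat.ofHom (Polynomial.mapAlgHom f.hom)
  map_id A := by ext : 1; exact Polynomial.mapAlgHom_id
  map_comp f g := by ext : 1; exact (Polynomial.mapAlgHom_comp _ _ _).symm

/-- The inclusion `A → A[t]` of the constants. -/
def polyIncl (k : Type u) [CommRing k] : 𝟭 (CommAlgCat.{u} k) ⟶ polyExt k where
  app A := CommAlgCat.ofHom ((Polynomial.CAlgHom (R := A) (A := A)).restrictScalars k)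
  naturality A B f := by
    ext : 1
    apply AlgHom.ext
    intro a
    exact (Polynomial.map_C f.hom.toRingHom).symm

/-- The canonical map `S → S[t]` of simplicial commutative `k`-algebras. -/
def toAffineLine {k : Type u} [CommRing k] (S : SCAlg k) :
    S ⟶ ((SimplicialObject.whiskering _ _).obj (polyExt k)).obj S :=
  Functor.whiskerLeft S (polyIncl k)

section Presheaves

variable {k : Type u} [CommRing k] (R : SCAlg k)

/-- The canonical map `S → S[t]` of simplicial commutative `R`-algebras. -/
def underToAffineLine (S : Under R) : S ⟶ Under.mk (S.hom ≫ toAffineLine S.right) :=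
  Under.homMk (toAffineLine S.right)

/-- A map of simplicial commutative `R`-algebras is a weak equivalence if it induces isomorphisms
on homotopy groups, that is, on the homology of the underlying simplicial `k`-modules. -/
def IsWeakEquivalence {S T : Under R} (f : S ⟶ T) : Prop :=
  QuasiIso ((AlgebraicTopology.alternatingFaceMapComplex (ModuleCat.{u} k)).map
    (((SimplicialObject.whiskering _ _).obj
      (forget₂ (CommAlgCat.{u} k) (AlgCat.{u} k) ⋙ forget₂ (AlgCat.{u} k) (ModuleCat.{u} k))).map
        f.right))

/-- Functors from simplicial commutative `R`-algebras to complexes of `k`-modules. -/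
abbrev Psh := Under R ⥤ CochainComplex (ModuleCat.{u} k) ℤ

/-- The objectwise quasi-isomorphisms. -/
def objectwiseQuasiIso : MorphismProperty (Psh R) :=
  (HomologicalComplex.quasiIso (ModuleCat.{u} k) (ComplexShape.up ℤ)).functorCategory (Under R)

/-- The localization functor from `Psh R` to its homotopy category, that is, the homotopy
category of functors with values in the derived category of `k`. -/
abbrev toHo : Psh R ⥤ (objectwiseQuasiIso R).Localization := (objectwiseQuasiIso R).Q

variable {R} in
/-- `F` descends to animated `R`-algebras (it inverts weak equivalences) and is
`𝔸¹`-invariant (it inverts `S → S[t]` for all `S`). -/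
structure IsA1Invariant (F : Psh R) : Prop where
  weakEquivalence : ∀ ⦃S T : Under R⦄ (f : S ⟶ T), IsWeakEquivalence R f → QuasiIso (F.map f)
  affineLine : ∀ S : Under R, QuasiIso (F.map (underToAffineLine R S))

variable {R} in
/-- `f : F ⟶ M` exhibits `M` as the `𝔸¹`-localization of `F`: the presheaf `M` is
`𝔸¹`-invariant, and `f` is the universal map from `F` to an `𝔸¹`-invariant presheaf. -/
structure IsA1Localization {F M : Psh R} (f : (toHo R).obj F ⟶ (toHo R).obj M) : Prop where
  invariant : IsA1Invariant M
  universal : ∀ G : Psh R, IsA1Invariant G →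
    Function.Bijective (fun g : (toHo R).obj M ⟶ (toHo R).obj G => f ≫ g)

end Presheaves

end A1Loc

end

/-! In characteristic `p` one has `d(rᵖ) = 0`, so multiplication by `rᵖ` is a chain endomorphism of
the de Rham complex of any algebra containing `r` (`extD_pow_char_smul`). This lets the coordinate
of the affine line contract the Suslin complex. A map `g : [n] → [1]` pulls the second coordinate of
`Δ¹` back to a function on `Δⁿ`, and multiplication by a `p`-th power attached to it acts on
`LΩ(S[Δⁿ])`, compatibly with the simplicial structure. The constant maps give the functions `0` and
`1`, so the simplicial homotopy of `IntervalAction.homotopy` joins the zero map to a map that should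
be the identity.

The de Rham complex is only taken on the polynomial resolution, so a function `b` on `A` has to be
lifted to `k[A]`. The lift `[b] - [0]` is natural in `A` and sends `0` to `0` strictly, but it sends
`1` to `[1] - [0]`. This differs from `1`, yet a 1-simplex of the resolution joins the two
(`unitPath`), so multiplication by `([1] - [0])ᵖ` is homotopic to the identity
(`quasiIso_discMul_one`). On the Suslin complex a quasi-isomorphism is thus homotopic to zero, which
proves acyclicity (`acyclic_suslin_derivedDeRham`).

For the universal property, the Suslin construction is an endofunctor `E` of presheaves that
preserves objectwise quasi-isomorphisms and receives a natural map from the identity. If `G` is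
`𝔸¹`-invariant, then `G → E G` is a monomorphism in the homotopy category (`mono_toHo_toSuslinPsh`),
because each `G(S) → G(S[Δᵐ])` is a quasi-isomorphism (`quasiIso_map_underIncl`). Two maps `F → G`
agree after composition with `G → E G`, since both composites factor through `E F`, which is zero
when `F = LΩ`. Hence `Hom(F, G)` has only one element, as does `Hom(0, G)`. -/

noncomputable section

namespace A1Loc

/-! ### Quasi-isomorphisms in terms of elements -/

section QuasiIsoElements

variable {k : Type u} [CommRing k] {K L : CochainComplex (ModuleCat.{u} k) ℤ}

lemma exists_iCycles_eq {i j : ℤ} (hij : i + 1 = j) (x : K.X i) (hx : K.d i j x = 0) :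
    ∃ z : K.cycles i, K.iCycles i z = x := by
  have h : ModuleCat.ofHom (LinearMap.toSpanSingleton k _ x) ≫ K.d i j = 0 := by
    ext
    simpa using hx
  refine ⟨K.liftCycles (ModuleCat.ofHom (LinearMap.toSpanSingleton k _ x)) j
    ((ComplexShape.up ℤ).next_eq' hij) h (1 : k), ?_⟩
  have h2 := K.liftCycles_i (ModuleCat.ofHom (LinearMap.toSpanSingleton k _ x)) j
    ((ComplexShape.up ℤ).next_eq' hij) h
  have h3 := ConcreteCategory.congr_hom h2 (1 : k)
  rw [ConcreteCategory.comp_apply] at h3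
  simpa using h3

lemma d_iCycles_apply {i j : ℤ} (z : K.cycles i) : K.d i j (K.iCycles i z) = 0 := by
  rw [← ConcreteCategory.comp_apply, K.iCycles_d]; rfl

lemma iCycles_injective (i : ℤ) : Function.Injective (K.iCycles i) :=
  (ModuleCat.mono_iff_injective _).mp inferInstance

lemma homologyπ_surjective (i : ℤ) : Function.Surjective (K.homologyπ i) :=
  (ModuleCat.epi_iff_surjective _).mp inferInstance

lemma homologyπ_eq_zero_iff {i j : ℤ} (hij : i + 1 = j) (z : K.cycles j) :
    K.homologyπ j z = 0 ↔ ∃ y : K.X i, K.d i j y = K.iCycles j z := by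
  have hex : (ShortComplex.mk _ _ (K.toCycles_comp_homologyπ i j)).Exact :=
    ShortComplex.exact_of_g_is_cokernel _
      (K.homologyIsCokernel i j ((ComplexShape.up ℤ).prev_eq' hij))
  constructor
  · intro hz
    obtain ⟨y, hy⟩ := (ShortComplex.moduleCat_exact_iff _).mp hex z hz
    refine ⟨y, ?_⟩
    rw [← K.toCycles_i i j, ConcreteCategory.comp_apply]
    exact congrArg _ hy
  · rintro ⟨y, hy⟩
    have : K.toCycles i j y = z := by
      apply iCycles_injective
      rw [← hy, ← ConcreteCategory.comp_apply, K.toCycles_i]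
    rw [← this, ← ConcreteCategory.comp_apply, K.toCycles_comp_homologyπ]
    rfl

lemma iCycles_cyclesMap_apply (f : K ⟶ L) (i : ℤ) (z : K.cycles i) :
    L.iCycles i (HomologicalComplex.cyclesMap f i z) = f.f i (K.iCycles i z) := by
  rw [← ConcreteCategory.comp_apply, HomologicalComplex.cyclesMap_i, ConcreteCategory.comp_apply]

lemma homologyMap_homologyπ_apply (f : K ⟶ L) (i : ℤ) (z : K.cycles i) :
    HomologicalComplex.homologyMap f i (K.homologyπ i z) =
      L.homologyπ i (HomologicalComplex.cyclesMap f i z) := by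
  rw [← ConcreteCategory.comp_apply, HomologicalComplex.homologyπ_naturality,
    ConcreteCategory.comp_apply]

/-- A map is a quasi-isomorphism exactly when its mapping cone has no homology, in terms of
elements. -/
lemma quasiIso_iff_elements (f : K ⟶ L) : QuasiIso f ↔
    ∀ (i : ℤ) (x : K.X (i + 1)) (y : L.X i), K.d (i + 1) (i + 1 + 1) x = 0 →
      f.f (i + 1) x = L.d i (i + 1) y →
      ∃ (x' : K.X i) (y' : L.X (i - 1)), K.d i (i + 1) x' = x ∧
        f.f i x' = y + L.d (i - 1) i y' := by
  have hcomm : ∀ (i j : ℤ) (x : K.X i), L.d i j (f.f i x) = f.f j (K.d i j x) := fun i j x => by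
    rw [← ConcreteCategory.comp_apply, f.comm, ConcreteCategory.comp_apply]
  constructor
  · intro hf i x y hx hxy
    have hiso : ∀ i, IsIso (HomologicalComplex.homologyMap f i) := fun i => inferInstance
    have hbij : ∀ i, Function.Bijective (HomologicalComplex.homologyMap f i) := fun i =>
      (ConcreteCategory.isIso_iff_bijective _).mp (hiso i)
    obtain ⟨z, rfl⟩ := exists_iCycles_eq rfl x hx
    have hz : K.homologyπ _ z = 0 := by
      apply (hbij _).1
      rw [homologyMap_homologyπ_apply, map_zero, homologyπ_eq_zero_iff rfl]
      exact ⟨y, by rw [iCycles_cyclesMap_apply, hxy]⟩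
    obtain ⟨x₀, hx₀⟩ := (homologyπ_eq_zero_iff rfl z).mp hz
    -- The primitive `x₀` of `x` need not match `y`, but `y - f x₀` is a cycle. By surjectivity on
    -- homology it is the image of a cycle of `K` up to a boundary, and that cycle corrects `x₀`.
    obtain ⟨w, hw⟩ := exists_iCycles_eq (K := L) rfl (y - f.f i x₀) (by
      rw [map_sub, hcomm, hx₀, hxy, sub_self])
    obtain ⟨v, hv⟩ := (hbij i).2 (L.homologyπ i w)
    obtain ⟨z', rfl⟩ := homologyπ_surjective i v
    rw [homologyMap_homologyπ_apply, ← sub_eq_zero, ← map_sub,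
      homologyπ_eq_zero_iff (i := i - 1) (by ring)] at hv
    obtain ⟨y', hy'⟩ := hv
    rw [map_sub, iCycles_cyclesMap_apply, hw] at hy'
    refine ⟨x₀ + K.iCycles i z', y', ?_, ?_⟩
    · rw [map_add, hx₀, d_iCycles_apply, add_zero]
    · rw [hy', map_add]; abel
  · intro h
    rw [quasiIso_iff]
    intro i
    rw [quasiIsoAt_iff_isIso_homologyMap, ConcreteCategory.isIso_iff_bijective]
    constructor
    · refine (injective_iff_map_eq_zero
        (HomologicalComplex.homologyMap f i).hom).mpr fun a ha => ?_
      obtain ⟨j, rfl⟩ : ∃ j, i = j + 1 := ⟨i - 1, by ring⟩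
      obtain ⟨z, rfl⟩ := homologyπ_surjective _ a
      change HomologicalComplex.homologyMap f (j + 1) _ = 0 at ha
      rw [homologyMap_homologyπ_apply, homologyπ_eq_zero_iff rfl] at ha
      obtain ⟨y, hy⟩ := ha
      rw [iCycles_cyclesMap_apply] at hy
      obtain ⟨x', y', hx', -⟩ := h j _ y (d_iCycles_apply z) hy.symm
      exact (homologyπ_eq_zero_iff rfl z).mpr ⟨x', hx'⟩
    · intro b
      obtain ⟨w, rfl⟩ := homologyπ_surjective _ b
      -- With `x = 0` the element `x'` is itself a cycle, and it maps to the class of `w`.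
      obtain ⟨x', y', hx', hy'⟩ := h i 0 (L.iCycles i w) (map_zero _) (by
        rw [map_zero, d_iCycles_apply])
      obtain ⟨z, rfl⟩ := exists_iCycles_eq rfl x' hx'
      refine ⟨K.homologyπ i z, ?_⟩
      rw [homologyMap_homologyπ_apply, ← sub_eq_zero, ← map_sub,
        homologyπ_eq_zero_iff (i := i - 1) (by ring)]
      refine ⟨y', ?_⟩
      rw [map_sub, iCycles_cyclesMap_apply, hy']; abel

end QuasiIsoElements

/-! ### Summands and differential of the total complex -/

section Tot

variable {k : Type u} [CommRing k]

/-- A chain complex of cochain complexes as a bicomplex with columns in nonpositive degrees. -/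
abbrev bicomplex (D : ChainComplex (CochainComplex (ModuleCat.{u} k) ℤ) ℕ) :
    HomologicalComplex₂ (ModuleCat.{u} k) (ComplexShape.up ℤ) (ComplexShape.up ℤ) :=
  D.extend ComplexShape.embeddingDownNat

/-- The direct-sum total complex of a chain complex of cochain complexes. -/
abbrev totObj (D : ChainComplex (CochainComplex (ModuleCat.{u} k) ℤ) ℕ) :
    CochainComplex (ModuleCat.{u} k) ℤ :=
  (bicomplex D).total (ComplexShape.up ℤ)

/-- The map of total complexes induced by a map of complexes of complexes. -/
abbrev totMap {D E : ChainComplex (CochainComplex (ModuleCat.{u} k) ℤ) ℕ} (φ : D ⟶ E) :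
    totObj D ⟶ totObj E :=
  HomologicalComplex₂.total.map (K := bicomplex D) (L := bicomplex E)
    (HomologicalComplex.extendMap φ ComplexShape.embeddingDownNat) (ComplexShape.up ℤ)

/-- The column of the bicomplex in degree `-p`. -/
def colIso (D : ChainComplex (CochainComplex (ModuleCat.{u} k) ℤ) ℕ) (p : ℕ) :
    HomologicalComplex.X (bicomplex D) (-(p : ℤ)) ≅ D.X p :=
  D.extendXIso ComplexShape.embeddingDownNat rfl

lemma bicomplex_d (D : ChainComplex (CochainComplex (ModuleCat.{u} k) ℤ) ℕ) (p q : ℕ) :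
    (bicomplex D).d (-(p : ℤ)) (-(q : ℤ)) = (colIso D p).hom ≫ D.d p q ≫ (colIso D q).inv :=
  D.extend_d_eq ComplexShape.embeddingDownNat rfl rfl

/-- The inclusion of a summand in the total complex. -/
def ιTot (D : ChainComplex (CochainComplex (ModuleCat.{u} k) ℤ) ℕ) (p : ℕ) (j n : ℤ)
    (h : j = n + p) : (D.X p).X j ⟶ (totObj D).X n :=
  (colIso D p).inv.f j ≫ (bicomplex D).ιTotal (ComplexShape.up ℤ) (-(p : ℤ)) j n (by
      change -(p : ℤ) + j = n; omega)

lemma colIso_hom_ιTot (D : ChainComplex (CochainComplex (ModuleCat.{u} k) ℤ) ℕ) (p : ℕ) (j n : ℤ)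
    (h : j = n + p) : (colIso D p).hom.f j ≫ ιTot D p j n h =
      (bicomplex D).ιTotal (ComplexShape.up ℤ) (-(p : ℤ)) j n (by
        change -(p : ℤ) + j = n; omega) := by
  rw [ιTot, ← Category.assoc, ← HomologicalComplex.comp_f, Iso.hom_inv_id,
    HomologicalComplex.id_f, Category.id_comp]

lemma tot_hom_ext {D : ChainComplex (CochainComplex (ModuleCat.{u} k) ℤ) ℕ} {n : ℤ}
    {A : ModuleCat.{u} k} {f g : (totObj D).X n ⟶ A}
    (h : ∀ p j hj, ιTot D p j n hj ≫ f = ιTot D p j n hj ≫ g) : f = g := by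
  apply HomologicalComplex₂.total.hom_ext
  intro i j hij
  have hij' : i + j = n := hij
  by_cases hi : ∃ p : ℕ, -(p : ℤ) = i
  · obtain ⟨p, rfl⟩ := hi
    rw [← colIso_hom_ιTot D p j n (by omega), Category.assoc, Category.assoc, h]
  -- The remaining columns, in positive degrees, are zero.
  · have hz := D.isZero_extend_X ComplexShape.embeddingDownNat i (fun p hp => hi ⟨p, hp⟩)
    exact ((HomologicalComplex.eval _ _ j).map_isZero hz).eq_of_src _ _

/-- The map from a total complex given by maps from all summands. -/
def totDesc (D : ChainComplex (CochainComplex (ModuleCat.{u} k) ℤ) ℕ) {n : ℤ}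
    {A : ModuleCat.{u} k} (f : ∀ (p : ℕ) (j : ℤ), j = n + p → ((D.X p).X j ⟶ A)) :
    (totObj D).X n ⟶ A :=
  HomologicalComplex₂.totalDesc (K := bicomplex D) (c₁₂ := ComplexShape.up ℤ) (i₁₂ := n)
    (fun i j hij =>
      if hi : i ≤ 0 then
        ((bicomplex D).XIsoOfEq (show i = -((-i).toNat : ℤ) by omega)).hom.f j ≫
          (colIso D (-i).toNat).hom.f j ≫ f (-i).toNat j (by
            change i + j = n at hij; omega)
      else 0)

lemma ιTot_desc (D : ChainComplex (CochainComplex (ModuleCat.{u} k) ℤ) ℕ) {n : ℤ}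
    {A : ModuleCat.{u} k} (f : ∀ (p : ℕ) (j : ℤ), j = n + p → ((D.X p).X j ⟶ A))
    (p : ℕ) (j : ℤ) (h : j = n + p) : ιTot D p j n h ≫ totDesc D f = f p j h := by
  -- The index `(-(-p)).toNat` produced by `totDesc` equals `p` only propositionally, so it is
  -- replaced by a variable `q` that can be substituted.
  have key : ∀ (q : ℕ) (e : -(p : ℤ) = -(q : ℤ)) (hq : j = n + q),
      (colIso D p).inv.f j ≫ ((bicomplex D).XIsoOfEq e).hom.f j ≫
        (colIso D q).hom.f j ≫ f q j hq = f p j h := by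
    intro q e hq
    obtain rfl : p = q := by omega
    rw [HomologicalComplex.XIsoOfEq_rfl, Iso.refl_hom, HomologicalComplex.id_f, Category.id_comp,
      ← HomologicalComplex.comp_f_assoc, Iso.inv_hom_id, HomologicalComplex.id_f,
      Category.id_comp]
  rw [ιTot, totDesc, Category.assoc, HomologicalComplex₂.ι_totalDesc, dif_pos (by omega)]
  exact key _ _ _

lemma ιTot_map {D E : ChainComplex (CochainComplex (ModuleCat.{u} k) ℤ) ℕ} (φ : D ⟶ E)
    (p : ℕ) (j n : ℤ) (h : j = n + p) :
    ιTot D p j n h ≫ (totMap φ).f n = (φ.f p).f j ≫ ιTot E p j n h := by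
  have hφ : (HomologicalComplex.extendMap φ ComplexShape.embeddingDownNat).f (-(p : ℤ)) =
      (colIso D p).hom ≫ φ.f p ≫ (colIso E p).inv :=
    HomologicalComplex.extendMap_f φ ComplexShape.embeddingDownNat rfl
  rw [ιTot, Category.assoc, HomologicalComplex₂.ιTotal_map, hφ, HomologicalComplex.comp_f,
    HomologicalComplex.comp_f, Category.assoc, Category.assoc, ← HomologicalComplex.comp_f_assoc,
    Iso.inv_hom_id, HomologicalComplex.id_f, Category.id_comp]
  rfl

lemma ιTot_D₂ (D : ChainComplex (CochainComplex (ModuleCat.{u} k) ℤ) ℕ)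
    (p : ℕ) (j j' n n' : ℤ) (h : j = n + p) (h' : j' = n' + p) (hn : n + 1 = n') :
    ιTot D p j n h ≫ (bicomplex D).D₂ (ComplexShape.up ℤ) n n' =
      (-1 : ℤ) ^ p • (D.X p).d j j' ≫ ιTot D p j' n' h' := by
  have hc : (bicomplex D).ιTotal (ComplexShape.up ℤ) (-(p : ℤ)) j' n' (by
        change -(p : ℤ) + j' = n'; omega) = _ := (colIso_hom_ιTot D p j' n' h').symm
  rw [ιTot, Category.assoc, HomologicalComplex₂.ι_D₂, HomologicalComplex₂.d₂_eq (bicomplex D) (ComplexShape.up ℤ) (-(p : ℤ))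
    (show (ComplexShape.up ℤ).Rel j j' by change j + 1 = j'; omega) n' (by
        change -(p : ℤ) + j' = n'; omega), hc]
  have hs : ComplexShape.ε₂ (ComplexShape.up ℤ) (ComplexShape.up ℤ) (ComplexShape.up ℤ)
      (-(p : ℤ), j) = (-1) ^ p := by
    change Int.negOnePow (-(p : ℤ)) = _
    rw [Int.negOnePow_neg]; rfl
  rw [hs, Units.smul_def, Units.val_pow_eq_pow_val, Preadditive.comp_zsmul,
    ← HomologicalComplex.Hom.comm_assoc, ← HomologicalComplex.comp_f_assoc, Iso.inv_hom_id,
    HomologicalComplex.id_f, Category.id_comp]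
  rfl

lemma ιTot_d_zero (D : ChainComplex (CochainComplex (ModuleCat.{u} k) ℤ) ℕ)
    (j j' n n' : ℤ) (h : j = n + (0 : ℕ)) (h' : j' = n' + (0 : ℕ)) (hn : n + 1 = n') :
    ιTot D 0 j n h ≫ (totObj D).d n n' = (D.X 0).d j j' ≫ ιTot D 0 j' n' h' := by
  rw [HomologicalComplex₂.total_d, Preadditive.comp_add, ιTot_D₂ D 0 j j' n n' h h' hn, pow_zero,
    one_smul, ιTot, Category.assoc, HomologicalComplex₂.ι_D₁,
    HomologicalComplex₂.d₁_eq' (bicomplex D) (ComplexShape.up ℤ)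
      (show (ComplexShape.up ℤ).Rel (-((0 : ℕ) : ℤ)) 1 by simp)]
  -- The horizontal differential out of column `0` lands in the zero column of degree `1`.
  have hz := D.isZero_extend_X ComplexShape.embeddingDownNat (1 : ℤ) (fun p hp => by
    change -(p : ℤ) = 1 at hp; omega)
  have h0 : ((bicomplex D).d (-((0 : ℕ) : ℤ)) 1).f j = 0 :=
    ((HomologicalComplex.eval _ _ j).map_isZero hz).eq_of_tgt _ _
  rw [h0, Limits.zero_comp, smul_zero, Limits.comp_zero, zero_add]

lemma ιTot_d_succ (D : ChainComplex (CochainComplex (ModuleCat.{u} k) ℤ) ℕ)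
    (p : ℕ) (j j' n n' : ℤ) (h : j = n + (p + 1 : ℕ)) (h' : j' = n' + (p + 1 : ℕ))
    (hn : n + 1 = n') :
    ιTot D (p + 1) j n h ≫ (totObj D).d n n' =
      (D.d (p + 1) p).f j ≫ ιTot D p j n' (by push_cast at h; omega) +
        (-1 : ℤ) ^ (p + 1) • (D.X (p + 1)).d j j' ≫ ιTot D (p + 1) j' n' h' := by
  have hc : (bicomplex D).ιTotal (ComplexShape.up ℤ) (-(p : ℤ)) j n' (by
        change -(p : ℤ) + j = n'; push_cast at h; omega) = _ :=
    (colIso_hom_ιTot D p j n' (by push_cast at h; omega)).symm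
  rw [HomologicalComplex₂.total_d, Preadditive.comp_add, ιTot_D₂ D (p + 1) j j' n n' h h' hn]
  congr 1
  rw [ιTot, Category.assoc, HomologicalComplex₂.ι_D₁,
    HomologicalComplex₂.d₁_eq (bicomplex D) (ComplexShape.up ℤ)
      (show (ComplexShape.up ℤ).Rel (-((p + 1 : ℕ) : ℤ)) (-(p : ℤ)) by
        change -((p + 1 : ℕ) : ℤ) + 1 = -(p : ℤ); push_cast; ring) j n' (by
        change -(p : ℤ) + j = n'; push_cast at h; omega), hc, bicomplex_d]
  change _ ≫ ((1 : ℤˣ) • _) = _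
  rw [one_smul, HomologicalComplex.comp_f, HomologicalComplex.comp_f]
  simp only [Category.assoc]
  rw [← HomologicalComplex.comp_f_assoc (colIso D (p + 1)).inv, Iso.inv_hom_id,
    HomologicalComplex.id_f, Category.id_comp, ← HomologicalComplex.comp_f_assoc (colIso D p).inv,
    Iso.inv_hom_id, HomologicalComplex.id_f, Category.id_comp]

end Tot

/-! ### The filtration by simplicial degree, and columnwise quasi-isomorphisms -/

section TotQuasiIso

variable {k : Type u} [CommRing k]
  (D : ChainComplex (CochainComplex (ModuleCat.{u} k) ℤ) ℕ)

/-- The part of the total complex in simplicial degrees `< N`. -/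
def totFilt (N : ℕ) (n : ℤ) : Submodule k ((totObj D).X n) :=
  ⨆ p : Fin N, LinearMap.range (ιTot D p (n + (p : ℕ)) n rfl).hom

lemma ιTot_mem_totFilt {N p : ℕ} (hp : p < N) (j n : ℤ) (h : j = n + p) (x : (D.X p).X j) :
    ιTot D p j n h x ∈ totFilt D N n := by
  subst h
  exact Submodule.mem_iSup_of_mem (p := fun p : Fin N =>
    LinearMap.range (ιTot D p (n + (p : ℕ)) n rfl).hom) ⟨p, hp⟩ ⟨x, rfl⟩

lemma totFilt_zero (n : ℤ) : totFilt D 0 n = ⊥ := by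
  rw [totFilt, iSup_of_empty]

lemma totFilt_mono {M N : ℕ} (h : M ≤ N) (n : ℤ) : totFilt D M n ≤ totFilt D N n :=
  iSup_le fun p => by
    rintro _ ⟨x, rfl⟩
    exact ιTot_mem_totFilt D (p.2.trans_le h) _ _ _ x

/-- The quotient map by `S` kills every summand, hence is zero. -/
lemma mem_of_ιTot_mem {n : ℤ} (S : Submodule k ((totObj D).X n))
    (h : ∀ p j hj y, ιTot D p j n hj y ∈ S) (x : (totObj D).X n) : x ∈ S := by
  have h0 : ModuleCat.ofHom S.mkQ = 0 := by
    apply tot_hom_ext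
    intro p j hj
    ext y
    exact (Submodule.Quotient.mk_eq_zero S).mpr (h p j hj y)
  exact (Submodule.Quotient.mk_eq_zero S).mp (ConcreteCategory.congr_hom h0 x)

/-- The filtration is exhaustive because the total complex is a direct sum: an element has only
finitely many nonzero components. This is what makes the induction in `quasiIso_totMap` reach every
element. -/
lemma exists_mem_totFilt (n : ℤ) (x : (totObj D).X n) : ∃ N, x ∈ totFilt D N n := by
  have hdir : Directed (· ≤ ·) (fun N => totFilt D N n) := fun a b =>
    ⟨max a b, totFilt_mono D (le_max_left _ _) n, totFilt_mono D (le_max_right _ _) n⟩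
  have hx : x ∈ ⨆ N, totFilt D N n := by
    refine mem_of_ιTot_mem D (⨆ N, totFilt D N n) (fun p j hj y => ?_) x
    exact Submodule.mem_iSup_of_mem (p := fun N => totFilt D N n) (p + 1)
      (ιTot_mem_totFilt D (Nat.lt_succ_self p) j n hj y)
  exact (Submodule.mem_iSup_of_directed _ hdir).mp hx

lemma mem_totFilt_succ {N : ℕ} {n : ℤ} {x : (totObj D).X n} (hx : x ∈ totFilt D (N + 1) n)
    (j : ℤ) (hj : j = n + N) : ∃ a : (D.X N).X j, x - ιTot D N j n hj a ∈ totFilt D N n := by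
  subst hj
  refine Submodule.iSup_induction _ (motive := fun x =>
    ∃ a : (D.X N).X (n + N), x - ιTot D N (n + N) n rfl a ∈ totFilt D N n) hx ?_ ?_ ?_
  · rintro ⟨p, hp⟩ _ ⟨y, rfl⟩
    rcases Nat.lt_succ_iff_lt_or_eq.mp hp with h | rfl
    · exact ⟨0, by rw [map_zero, sub_zero]; exact ιTot_mem_totFilt D h _ _ _ y⟩
    · exact ⟨y, by rw [sub_eq_zero_of_eq rfl]; exact Submodule.zero_mem _⟩
  · exact ⟨0, by rw [map_zero, sub_zero]; exact Submodule.zero_mem _⟩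
  · rintro x y ⟨a, ha⟩ ⟨b, hb⟩
    refine ⟨a + b, ?_⟩
    rw [map_add, add_sub_add_comm]
    exact Submodule.add_mem _ ha hb

/-- The projection to a summand of the total complex. -/
def πTot (p : ℕ) (j n : ℤ) (h : j = n + p) : (totObj D).X n ⟶ (D.X p).X j :=
  totDesc D fun q i hi =>
    if e : q = p then eqToHom (by subst e; rw [hi, h]) else 0

lemma πTot_ιTot (p : ℕ) (j n : ℤ) (h : j = n + p) (x : (D.X p).X j) :
    πTot D p j n h (ιTot D p j n h x) = x := by
  have : ιTot D p j n h ≫ πTot D p j n h = 𝟙 _ := by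
    rw [πTot, ιTot_desc, dif_pos rfl, eqToHom_refl]
  exact ConcreteCategory.congr_hom this x

lemma πTot_eq_zero {N p : ℕ} (hp : N ≤ p) (j n : ℤ) (h : j = n + p) {x : (totObj D).X n}
    (hx : x ∈ totFilt D N n) : πTot D p j n h x = 0 := by
  have hle : totFilt D N n ≤ LinearMap.ker (πTot D p j n h).hom := iSup_le fun q => by
    rintro _ ⟨y, rfl⟩
    have : ιTot D q _ n rfl ≫ πTot D p j n h = 0 := by
      rw [πTot, ιTot_desc, dif_neg (q.2.trans_le hp).ne]
    exact ConcreteCategory.congr_hom this y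
  exact hle hx

/-- The face part of the differential lowers the column, so the graded pieces of the filtration are
the columns, with differential changed by the sign `(-1)ᵖ`. -/
lemma d_ιTot_mem (p : ℕ) (j j' n n' : ℤ) (h : j = n + p) (h' : j' = n' + p) (hn : n + 1 = n')
    (x : (D.X p).X j) :
    (totObj D).d n n' (ιTot D p j n h x) - (-1 : ℤ) ^ p • ιTot D p j' n' h' ((D.X p).d j j' x) ∈
      totFilt D p n' := by
  cases p with
  | zero =>
    have := ConcreteCategory.congr_hom (ιTot_d_zero D j j' n n' h h' hn) x
    rw [ConcreteCategory.comp_apply, ConcreteCategory.comp_apply] at this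
    rw [this, pow_zero, one_smul, sub_self]
    exact Submodule.zero_mem _
  | succ p =>
    have := ConcreteCategory.congr_hom (ιTot_d_succ D p j j' n n' h h' hn) x
    rw [ConcreteCategory.comp_apply] at this
    rw [this]
    have h2 : ∀ (a b c : (totObj D).X n'), b = c → a ∈ totFilt D (p + 1) n' →
        a + b - c ∈ totFilt D (p + 1) n' := fun a b c e ha => by
      rwa [e, add_sub_cancel_right]
    exact h2 _ _ _ rfl
      (ιTot_mem_totFilt D (Nat.lt_succ_self p) j n' (by push_cast at h; omega) _)

lemma d_mem_totFilt (N : ℕ) (n n' : ℤ) (hn : n + 1 = n') {x : (totObj D).X n}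
    (hx : x ∈ totFilt D N n) : (totObj D).d n n' x ∈ totFilt D N n' := by
  have hle : totFilt D N n ≤ (totFilt D N n').comap ((totObj D).d n n').hom :=
    iSup_le fun q => by
      rintro _ ⟨y, rfl⟩
      have h := totFilt_mono D q.2.le _
        (d_ιTot_mem D q (n + (q : ℕ)) (n' + (q : ℕ)) n n' rfl rfl hn y)
      have h2 := Submodule.add_mem _ h (zsmul_mem (ιTot_mem_totFilt D q.2 _ n' rfl
        ((D.X q).d (n + (q : ℕ)) (n' + (q : ℕ)) y)) ((-1) ^ (q : ℕ)))
      rwa [sub_add_cancel] at h2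
  exact hle hx

variable {D} {E : ChainComplex (CochainComplex (ModuleCat.{u} k) ℤ) ℕ}

lemma totMap_ιTot (f : D ⟶ E) (p : ℕ) (j n : ℤ) (h : j = n + p) (x : (D.X p).X j) :
    (totMap f).f n (ιTot D p j n h x) = ιTot E p j n h ((f.f p).f j x) := by
  have := ConcreteCategory.congr_hom (ιTot_map f p j n h) x
  rwa [ConcreteCategory.comp_apply, ConcreteCategory.comp_apply] at this

lemma totMap_mem_totFilt (f : D ⟶ E) (N : ℕ) (n : ℤ) {x : (totObj D).X n}
    (hx : x ∈ totFilt D N n) : (totMap f).f n x ∈ totFilt E N n := by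
  have hle : totFilt D N n ≤ (totFilt E N n).comap ((totMap f).f n).hom :=
    iSup_le fun q => by
      rintro _ ⟨y, rfl⟩
      change (totMap f).f n (ιTot D q (n + (q : ℕ)) n rfl y) ∈ totFilt E N n
      rw [totMap_ιTot]
      exact ιTot_mem_totFilt E q.2 _ _ _ _
  exact hle hx

/-- The total complex preserves columnwise quasi-isomorphisms. -/
theorem quasiIso_totMap (f : D ⟶ E) (hf : ∀ p, QuasiIso (f.f p)) : QuasiIso (totMap f) := by
  rw [quasiIso_iff_elements]
  have hcomm : ∀ (i j : ℤ) (x : (totObj D).X i),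
      (totObj E).d i j ((totMap f).f i x) = (totMap f).f j ((totObj D).d i j x) := fun i j x => by
    rw [← ConcreteCategory.comp_apply, (totMap f).comm, ConcreteCategory.comp_apply]
  have hdd : ∀ (K : CochainComplex (ModuleCat.{u} k) ℤ) (i j l : ℤ) (x : K.X i),
      K.d j l (K.d i j x) = 0 := fun K i j l x => by
    rw [← ConcreteCategory.comp_apply, K.d_comp_d]; rfl
  -- The pair `(x, y)` is a cycle of the mapping cone. It is shown to be a boundary by induction on
  -- its filtration, removing the top component `(a, b)` at each stage.
  suffices H : ∀ (N : ℕ) (i : ℤ) (x : (totObj D).X (i + 1)) (y : (totObj E).X i),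
      x ∈ totFilt D N _ → y ∈ totFilt E N _ → (totObj D).d (i + 1) (i + 1 + 1) x = 0 →
      (totMap f).f (i + 1) x = (totObj E).d i (i + 1) y →
      ∃ (x' : (totObj D).X i) (y' : (totObj E).X (i - 1)), (totObj D).d i (i + 1) x' = x ∧
        (totMap f).f i x' = y + (totObj E).d (i - 1) i y' by
    intro i x y hx hxy
    obtain ⟨N₁, h₁⟩ := exists_mem_totFilt D _ x
    obtain ⟨N₂, h₂⟩ := exists_mem_totFilt E _ y
    exact H (max N₁ N₂) i x y (totFilt_mono D (le_max_left _ _) _ h₁)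
      (totFilt_mono E (le_max_right _ _) _ h₂) hx hxy
  intro N
  induction N with
  | zero =>
    intro i x y hx hy _ _
    rw [totFilt_zero, Submodule.mem_bot] at hx hy
    subst hx hy
    exact ⟨0, 0, by simp, by simp⟩
  | succ N ih =>
    intro i x y hx hy hdx hxy
    obtain ⟨m, hm⟩ : ∃ m : ℤ, m = i + N := ⟨_, rfl⟩
    obtain ⟨a, ha⟩ := mem_totFilt_succ D hx (m + 1) (by omega)
    obtain ⟨b, hb⟩ := mem_totFilt_succ E hy m (by omega)
    have hunit : ∀ {M : Type u} [AddCommGroup M] (z : M),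
        (-1 : ℤ) ^ N • (-1 : ℤ) ^ N • z = z := fun z => by
      rw [smul_smul, ← pow_add, Even.neg_one_pow ⟨N, rfl⟩, one_smul]
    -- Column `N` of the equation `dx = 0`; terms of lower filtration do not contribute.
    have hda : (D.X N).d (m + 1) (m + 1 + 1) a = 0 := by
      have h1 := d_mem_totFilt D N (i + 1) (i + 1 + 1) rfl ha
      have h2 := d_ιTot_mem D N (m + 1) (m + 1 + 1) (i + 1) (i + 1 + 1) (by omega) (by omega) rfl a
      rw [map_sub, hdx, zero_sub] at h1
      have h3 := πTot_eq_zero D le_rfl (m + 1 + 1) _ (by omega) (Submodule.add_mem _ h1 h2)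
      rw [neg_add_eq_sub, sub_right_comm, sub_self, zero_sub, map_neg, map_zsmul, πTot_ιTot,
        neg_eq_zero] at h3
      rw [← hunit ((D.X N).d (m + 1) (m + 1 + 1) a), h3, smul_zero]
    -- Column `N` of the equation `f x = dy`. The sign of the vertical differential is moved onto
    -- `b`, so that `(a, ±b)` is a cycle of the cone of `f.f N`.
    have hab : (f.f N).f (m + 1) a = (E.X N).d m (m + 1) ((-1 : ℤ) ^ N • b) := by
      have h1 := totMap_mem_totFilt f N _ ha
      rw [map_sub, totMap_ιTot] at h1
      have h2 := d_mem_totFilt E N i (i + 1) rfl hb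
      rw [map_sub] at h2
      have h3 := d_ιTot_mem E N m (m + 1) i (i + 1) (by omega) (by omega) rfl b
      have h4 := πTot_eq_zero E le_rfl (m + 1) _ (by omega)
        (Submodule.sub_mem _ (Submodule.add_mem _ h2 h3) h1)
      rw [hxy, sub_add_sub_cancel, sub_sub_sub_cancel_left, map_sub, map_zsmul, πTot_ιTot,
        πTot_ιTot, sub_eq_zero] at h4
      rw [h4, map_zsmul]
    obtain ⟨a', b', ha', hb'⟩ := (quasiIso_iff_elements (f.f N)).mp (hf N) m a _ hda hab
    have h1 := d_ιTot_mem D N m (m + 1) i (i + 1) (by omega) (by omega) rfl ((-1 : ℤ) ^ N • a')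
    rw [map_zsmul (ConcreteCategory.hom ((D.X N).d m (m + 1))),
      map_zsmul (ConcreteCategory.hom (ιTot D N (m + 1) (i + 1) _)), hunit, ha'] at h1
    have h2 := d_ιTot_mem E N (m - 1) m (i - 1) i (by omega) (by omega) (by omega) b'
    -- Subtracting the boundary in the cone given by the columnwise solution `(a', b')` cancels the
    -- top components and leaves a cycle of filtration `N`.
    obtain ⟨x₁, y₁, hx₁, hy₁⟩ := ih i
      (x - (totObj D).d i (i + 1) (ιTot D N m i (by omega) ((-1 : ℤ) ^ N • a')))
      (y - (totMap f).f i (ιTot D N m i (by omega) ((-1 : ℤ) ^ N • a')) +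
        (totObj E).d (i - 1) i (ιTot E N (m - 1) (i - 1) (by omega) b'))
      (by
        have := Submodule.sub_mem _ ha h1
        rwa [sub_sub_sub_cancel_right] at this)
      (by
        have h3 := Submodule.add_mem _ hb h2
        rw [totMap_ιTot, map_zsmul, map_zsmul, hb', map_add, smul_add, map_zsmul, hunit]
        convert h3 using 1
        abel)
      (by rw [map_sub, hdx, hdd, sub_zero])
      (by rw [map_sub, map_add, map_sub, hxy, hdd, add_zero, hcomm])
    refine ⟨x₁ + ιTot D N m i (by omega) ((-1 : ℤ) ^ N • a'),
      y₁ + ιTot E N (m - 1) (i - 1) (by omega) b', ?_, ?_⟩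
    · rw [map_add, hx₁, sub_add_cancel]
    · rw [map_add, hy₁, map_add]; abel

end TotQuasiIso

/-! ### Homotopies of total complexes -/

section TotHomotopy

variable {k : Type u} [CommRing k]
  {D E : ChainComplex (CochainComplex (ModuleCat.{u} k) ℤ) ℕ} {f g : D ⟶ E}

/-- The components of the homotopy of total complexes induced by a homotopy. -/
def totHomotopyHom (H : Homotopy f g) (i j : ℤ) : (totObj D).X i ⟶ (totObj E).X j :=
  if h : j + 1 = i then
    totDesc D (fun p m hm => (H.hom p (p + 1)).f m ≫
      ιTot E (p + 1) m j (by push_cast; omega))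
  else 0

lemma ιTot_totHomotopyHom (H : Homotopy f g) (p : ℕ) (m i j : ℤ) (h : m = i + p)
    (hij : j + 1 = i) :
    ιTot D p m i h ≫ totHomotopyHom H i j =
      (H.hom p (p + 1)).f m ≫ ιTot E (p + 1) m j (by push_cast; omega) := by
  rw [totHomotopyHom, dif_pos hij, ιTot_desc]

/-- The total complex preserves homotopies. -/
def totHomotopy (H : Homotopy f g) : Homotopy (totMap f) (totMap g) where
  hom := totHomotopyHom H
  zero i j hij := dif_neg hij
  comm i := by
    rw [dNext_eq _ (show (ComplexShape.up ℤ).Rel i (i + 1) from rfl),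
      prevD_eq _ (show (ComplexShape.up ℤ).Rel (i - 1) i from sub_add_cancel i 1)]
    apply tot_hom_ext
    intro p m hm
    -- The vertical differentials in columns `p` and `p + 1` carry opposite signs, and each
    -- component of `H` commutes with them, so the vertical terms cancel. The horizontal terms give
    -- exactly this identity.
    have hc := congrArg (fun t => HomologicalComplex.Hom.f t m) (H.comm p)
    rw [Preadditive.comp_add, Preadditive.comp_add, ιTot_map, ιTot_map]
    rw [← Category.assoc, ← Category.assoc, ιTot_totHomotopyHom H p m i (i - 1) hm (by ring),
      Category.assoc, Category.assoc, ιTot_d_succ E p m (m + 1) (i - 1) i (by push_cast; omega)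
        (by push_cast; omega) (by ring)]
    cases p with
    | zero =>
      rw [← Category.assoc (ιTot D 0 m i hm), ιTot_d_zero D m (m + 1) i (i + 1) hm (by omega) rfl, Category.assoc,
        ιTot_totHomotopyHom H 0 (m + 1) (i + 1) i (by omega) rfl]
      rw [dNext_eq_zero _ _ (by simp), prevD_eq _ (show (ComplexShape.down ℕ).Rel 1 0 from rfl)]
        at hc
      simp only [zero_add, HomologicalComplex.add_f_apply, HomologicalComplex.comp_f] at hc
      rw [hc]
      simp only [Preadditive.add_comp, Preadditive.comp_add, Category.assoc, zero_add, pow_one,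
        neg_smul, one_smul, Preadditive.comp_neg, HomologicalComplex.Hom.comm_assoc]
      abel
    | succ p =>
      rw [← Category.assoc (ιTot D (p + 1) m i hm), ιTot_d_succ D p m (m + 1) i (i + 1) hm (by omega) rfl, Preadditive.add_comp,
        Preadditive.zsmul_comp, Category.assoc, Category.assoc,
        ιTot_totHomotopyHom H (p + 1) (m + 1) (i + 1) i (by omega) rfl,
        ιTot_totHomotopyHom H p m (i + 1) i (by push_cast at hm; omega) rfl]
      rw [dNext_eq _ (show (ComplexShape.down ℕ).Rel (p + 1) p from rfl),
        prevD_eq _ (show (ComplexShape.down ℕ).Rel (p + 1 + 1) (p + 1) from rfl)] at hc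
      simp only [HomologicalComplex.add_f_apply, HomologicalComplex.comp_f] at hc
      rw [hc]
      simp only [Preadditive.add_comp, Preadditive.comp_add, Category.assoc, pow_succ,
        mul_neg, mul_one, neg_neg, neg_smul, Preadditive.comp_zsmul,
        HomologicalComplex.Hom.comm_assoc]
      abel

end TotHomotopy

/-! ### Realization: homotopies, zero simplices and constant objects -/

section Realization

variable {k : Type u} [CommRing k]

lemma quasiIso_realization_map {X Y : SimplicialObject (CochainComplex (ModuleCat.{u} k) ℤ)}
    (f : X ⟶ Y) (hf : ∀ n, QuasiIso (f.app n)) : QuasiIso ((realization k).map f) :=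
  quasiIso_totMap ((AlgebraicTopology.alternatingFaceMapComplex _).map f) fun _ => hf _

/-- The realizations of simplicially homotopic maps are homotopic. -/
def realizationHomotopy {X Y : SimplicialObject (CochainComplex (ModuleCat.{u} k) ℤ)}
    {f g : X ⟶ Y} (H : SimplicialObject.Homotopy f g) :
    Homotopy ((realization k).map f) ((realization k).map g) :=
  totHomotopy H.toChainHomotopy

lemma realization_map_eq_zero {X Y : SimplicialObject (CochainComplex (ModuleCat.{u} k) ℤ)}
    (f : X ⟶ Y) (hf : ∀ n, f.app n = 0) : (realization k).map f = 0 := by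
  ext n : 1
  apply tot_hom_ext
  intro p j hj
  refine (ιTot_map ((AlgebraicTopology.alternatingFaceMapComplex _).map f) p j n hj).trans ?_
  have : ((AlgebraicTopology.alternatingFaceMapComplex _).map f).f p = 0 := hf _
  rw [this, HomologicalComplex.zero_f, Limits.zero_comp]
  exact Limits.comp_zero.symm

/-- The inclusion of the complex of `0`-simplices in the realization. -/
def zeroSimplices (X : SimplicialObject (CochainComplex (ModuleCat.{u} k) ℤ)) :
    X.obj (Opposite.op (SimplexCategory.mk 0)) ⟶ (realization k).obj X where
  f n := ιTot ((AlgebraicTopology.alternatingFaceMapComplex _).obj X) 0 n n (by simp)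
  comm' n n' hn :=
    ιTot_d_zero ((AlgebraicTopology.alternatingFaceMapComplex _).obj X) n n' n n'
      (by simp) (by simp) hn

lemma zeroSimplices_naturality {X Y : SimplicialObject (CochainComplex (ModuleCat.{u} k) ℤ)}
    (f : X ⟶ Y) : f.app _ ≫ zeroSimplices Y = zeroSimplices X ≫ (realization k).map f := by
  ext n : 1
  exact (ιTot_map ((AlgebraicTopology.alternatingFaceMapComplex _).map f) 0 n n (by simp)).symm

/-- Both faces are the identity and cancel in the alternating sum. This makes the projection of the
total complex to column `0` compatible with the differentials. -/
lemma constComplex_d_one (K : CochainComplex (ModuleCat.{u} k) ℤ) :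
    ((AlgebraicTopology.alternatingFaceMapComplex _).obj
      ((SimplicialObject.const _).obj K)).d 1 0 = 0 := by
  rw [AlgebraicTopology.alternatingFaceMapComplex_obj_d,
    AlgebraicTopology.AlternatingFaceMapComplex.objD, Fin.sum_univ_two]
  simp [SimplicialObject.δ]

/-- The components of the augmentation of the realization of a constant simplicial complex. -/
def constRetractionHom (K : CochainComplex (ModuleCat.{u} k) ℤ) (n : ℤ) :
    (totObj ((AlgebraicTopology.alternatingFaceMapComplex _).obj
      ((SimplicialObject.const _).obj K))).X n ⟶ K.X n :=
  totDesc _ fun p j hj =>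
    if h : p = 0 then (K.XIsoOfEq (by subst h; simpa using hj)).hom else 0

lemma ιTot_zero_constRetractionHom (K : CochainComplex (ModuleCat.{u} k) ℤ) (n : ℤ)
    (h : n = n + (0 : ℕ)) :
    ιTot ((AlgebraicTopology.alternatingFaceMapComplex _).obj
      ((SimplicialObject.const _).obj K)) 0 n n h ≫ constRetractionHom K n = 𝟙 (K.X n) := by
  rw [constRetractionHom, ιTot_desc, dif_pos rfl, HomologicalComplex.XIsoOfEq_rfl, Iso.refl_hom]

lemma ιTot_succ_constRetractionHom (K : CochainComplex (ModuleCat.{u} k) ℤ) (p : ℕ) (j n : ℤ)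
    (h : j = n + (p + 1 : ℕ)) :
    ιTot ((AlgebraicTopology.alternatingFaceMapComplex _).obj
      ((SimplicialObject.const _).obj K)) (p + 1) j n h ≫ constRetractionHom K n = 0 := by
  rw [constRetractionHom, ιTot_desc, dif_neg (Nat.succ_ne_zero p)]

lemma constRetractionHom_comm (K : CochainComplex (ModuleCat.{u} k) ℤ) (n n' : ℤ)
    (hn : n + 1 = n') :
    constRetractionHom K n ≫ K.d n n' =
      (totObj ((AlgebraicTopology.alternatingFaceMapComplex _).obj
        ((SimplicialObject.const _).obj K))).d n n' ≫ constRetractionHom K n' := by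
  apply tot_hom_ext
  intro p j hj
  rw [← Category.assoc, ← Category.assoc]
  rcases p with _ | p
  · obtain rfl : j = n := by simpa using hj
    rw [ιTot_zero_constRetractionHom, ιTot_d_zero _ j n' j n' hj (by simp) hn, Category.assoc,
      ιTot_zero_constRetractionHom]
    exact (Category.id_comp _).trans (Category.comp_id _).symm
  · rw [ιTot_succ_constRetractionHom, ιTot_d_succ _ p j (j + 1) n n' hj
      (by push_cast at hj ⊢; omega) hn, Preadditive.add_comp, Preadditive.zsmul_comp,
      Category.assoc, Category.assoc, ιTot_succ_constRetractionHom, Limits.comp_zero, smul_zero,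
      add_zero, Limits.zero_comp]
    rcases p with _ | p
    · rw [constComplex_d_one, HomologicalComplex.zero_f, Limits.zero_comp]
    · rw [ιTot_succ_constRetractionHom, Limits.comp_zero]

/-- The augmentation of the realization of a constant simplicial complex. -/
def constRetraction (K : CochainComplex (ModuleCat.{u} k) ℤ) :
    (realization k).obj ((SimplicialObject.const _).obj K) ⟶ K where
  f n := constRetractionHom K n
  comm' n n' hn := constRetractionHom_comm K n n' hn

lemma constRetraction_naturality {K L : CochainComplex (ModuleCat.{u} k) ℤ} (f : K ⟶ L) :
    (realization k).map ((SimplicialObject.const _).map f) ≫ constRetraction L =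
      constRetraction K ≫ f := by
  ext n : 1
  apply tot_hom_ext
  intro p j hj
  refine (Category.assoc _ _ _).symm.trans (Eq.trans ?_ (Category.assoc _ _ _))
  refine (congrArg (· ≫ constRetractionHom L n) (ιTot_map
    ((AlgebraicTopology.alternatingFaceMapComplex _).map
      ((SimplicialObject.const _).map f)) p j n hj)).trans ?_
  change (_ ≫ _) ≫ _ = (_ ≫ constRetractionHom K n) ≫ f.f n
  rw [Category.assoc]
  rcases p with _ | p
  · obtain rfl : j = n := by simpa using hj
    rw [ιTot_zero_constRetractionHom, ιTot_zero_constRetractionHom]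
    exact (Category.comp_id _).trans (Category.id_comp _).symm
  · rw [ιTot_succ_constRetractionHom, ιTot_succ_constRetractionHom, Limits.comp_zero,
      Limits.zero_comp]

/-- A one-sided inverse is enough below: it makes the inclusion of the zero simplices a split
monomorphism. -/
lemma zeroSimplices_constRetraction (K : CochainComplex (ModuleCat.{u} k) ℤ) :
    zeroSimplices ((SimplicialObject.const _).obj K) ≫ constRetraction K = 𝟙 K := by
  ext n : 1
  exact ιTot_zero_constRetractionHom K n (by simp)

end Realization

/-! ### Simplicial homotopies from an action of the interval -/

section SimplicialHomotopy

open Simplicial Opposite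

variable {C : Type*} [Category* C] (X : SimplicialObject C)

/-- A family of endomorphisms of the terms of `X`, indexed by the simplices of the interval: a
simplicial action of the interval on `X`. -/
structure IntervalAction where
  act : ∀ n : SimplexCategoryᵒᵖ, (n.unop ⟶ ⦋1⦌) → (X.obj n ⟶ X.obj n)
  naturality : ∀ {n m : SimplexCategoryᵒᵖ} (α : n ⟶ m) (g : n.unop ⟶ ⦋1⦌),
    X.map α ≫ act m (α.unop ≫ g) = act n g ≫ X.map α

/-- The simplex of the interval which is `0` on the points `≤ i` and `1` on the others. -/
def stepSimplex (n i : ℕ) : ⦋n⦌ ⟶ ⦋1⦌ :=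
  SimplexCategory.mkHom ⟨fun j => if (j : ℕ) ≤ i then 0 else 1, fun a b hab => by
    have : (a : ℕ) ≤ b := hab
    dsimp only
    split_ifs <;> first | omega | simp⟩

lemma stepSimplex_apply (n i : ℕ) (j : Fin (n + 1)) :
    (stepSimplex n i).toOrderHom j = if (j : ℕ) ≤ i then 0 else 1 := rfl

variable {X}

/-- The endomorphism of `X` given by a vertex of the interval. -/
def IntervalAction.vertex (A : IntervalAction X) (c : Fin 2) : X ⟶ X where
  app n := A.act n (SimplexCategory.const _ ⦋1⦌ c)
  naturality n m α := by
    rw [← A.naturality]; rfl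

lemma δ_comp_stepSimplex {n : ℕ} (i : Fin (n + 2)) {a b : ℕ}
    (h : ∀ x : Fin (n + 1), (i.succAbove x : ℕ) ≤ a ↔ (x : ℕ) ≤ b) :
    SimplexCategory.δ i ≫ stepSimplex (n + 1) a = stepSimplex n b := by
  ext x : 3
  exact if_congr (h x) rfl rfl

lemma σ_comp_stepSimplex {n : ℕ} (i : Fin (n + 1)) {a b : ℕ}
    (h : ∀ x : Fin (n + 2), (i.predAbove x : ℕ) ≤ a ↔ (x : ℕ) ≤ b) :
    SimplexCategory.σ i ≫ stepSimplex n a = stepSimplex (n + 1) b := by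
  ext x : 3
  exact if_congr (h x) rfl rfl

lemma IntervalAction.act_δ (A : IntervalAction X) {n : ℕ} (g : ⦋n + 1⦌ ⟶ ⦋1⦌)
    (i : Fin (n + 2)) :
    A.act (op ⦋n + 1⦌) g ≫ X.δ i = X.δ i ≫ A.act (op ⦋n⦌) (SimplexCategory.δ i ≫ g) :=
  (A.naturality (SimplexCategory.δ i).op g).symm

lemma IntervalAction.act_σ (A : IntervalAction X) {n : ℕ} (g : ⦋n⦌ ⟶ ⦋1⦌)
    (i : Fin (n + 1)) :
    A.act (op ⦋n⦌) g ≫ X.σ i = X.σ i ≫ A.act (op ⦋n + 1⦌) (SimplexCategory.σ i ≫ g) :=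
  (A.naturality (SimplexCategory.σ i).op g).symm

/-- The homotopy between the two ends of an action of the interval. -/
def IntervalAction.homotopy (A : IntervalAction X) :
    SimplicialObject.Homotopy (A.vertex 0) (A.vertex 1) where
  -- The prism decomposition: the steps are the nonconstant maps to `[1]`. By naturality of the
  -- action each homotopy identity reduces to a simplicial identity in `X` and the pullback of a
  -- step along a face or a degeneracy.
  h {n} i := X.σ i ≫ A.act (op ⦋n + 1⦌) (stepSimplex (n + 1) i)
  h_zero_comp_δ_zero n := by
    rw [Category.assoc, A.act_δ, X.δ_comp_σ_self'_assoc (by simp)]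
    refine congrArg (A.act (op ⦋n⦌)) ?_
    ext x : 3
    -- The step takes the value `0` only at the point `0`, which this face omits; the constant `1`
    -- remains.
    have hx : ¬ (((0 : Fin (n + 2)).succAbove x : Fin (n + 2)) : ℕ) ≤ ((0 : Fin (n + 1)) : ℕ) := by
      simp
    exact (stepSimplex_apply (n + 1) _ ((0 : Fin (n + 2)).succAbove x)).trans (if_neg hx)
  h_last_comp_δ_last n := by
    rw [Category.assoc, A.act_δ, X.δ_comp_σ_succ'_assoc (by simp)]
    refine congrArg (A.act (op ⦋n⦌)) ?_
    ext x : 3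
    -- The step takes the value `1` only at the last point, which this face omits; the constant `0`
    -- remains.
    refine if_pos ?_
    change (((Fin.last (n + 1)).succAbove x : Fin (n + 2)) : ℕ) ≤ n
    rw [Fin.succAbove_last]
    exact Nat.lt_succ_iff.mp x.2
  h_succ_comp_δ_castSucc_of_lt i j hij := by
    rw [Category.assoc, A.act_δ, X.δ_comp_σ_of_le_assoc hij, δ_comp_stepSimplex (b := j)]
    intro x
    simp only [Fin.succAbove, Fin.lt_def, Fin.le_def, Fin.val_castSucc, Fin.val_succ] at hij ⊢
    split_ifs <;> simp <;> omega
  h_succ_comp_δ_castSucc_succ {n} j := by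
    rw [Category.assoc, Category.assoc, A.act_δ, A.act_δ, X.δ_comp_σ_self'_assoc (by simp),
      X.δ_comp_σ_succ'_assoc (by simp), δ_comp_stepSimplex (b := j),
      δ_comp_stepSimplex (b := j)]
    all_goals
      intro x
      simp only [Fin.succAbove, Fin.lt_def, Fin.val_castSucc, Fin.val_succ]
      split_ifs <;> simp <;> omega
  h_castSucc_comp_δ_succ_of_lt i j hji := by
    rw [Category.assoc, A.act_δ, X.δ_comp_σ_of_gt_assoc hji, δ_comp_stepSimplex (b := j)]
    intro x
    simp only [Fin.succAbove, Fin.lt_def, Fin.val_castSucc, Fin.val_succ] at hji ⊢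
    split_ifs <;> simp <;> omega
  h_comp_σ_castSucc_of_le i j hij := by
    rw [Category.assoc, A.act_σ, X.σ_comp_σ_assoc hij, σ_comp_stepSimplex (b := j.succ)]
    intro x
    simp only [Fin.predAbove, Fin.lt_def, Fin.le_def, Fin.val_castSucc, Fin.val_succ] at hij ⊢
    split_ifs <;> simp <;> omega
  h_comp_σ_succ_of_lt i j hji := by
    rw [Category.assoc, A.act_σ, ← X.σ_comp_σ_assoc hji, σ_comp_stepSimplex (b := j)]
    · rfl
    intro x
    simp only [Fin.predAbove, Fin.lt_def, Fin.le_def, Fin.val_castSucc, Fin.val_succ] at hji ⊢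
    split_ifs <;> simp <;> omega

end SimplicialHomotopy

/-! ### Multiplication by `p`-th powers on the de Rham complex -/

section Frobenius

open DeRham

variable (p : ℕ) {k : Type u} [Field k] [CharP k p]

section

variable {A : Type u} [CommRing A] [Algebra k A]

/-- `d(rᵖ) = p rᵖ⁻¹ dr`, and `p = 0` in `A`. This is the point at which the characteristic enters.
-/
lemma dOne_pow_char (r : A) : (dOne (r ^ p) : Forms k A) = 0 := by
  have hp : (p : A) = 0 := by
    rw [← map_natCast (algebraMap k A), CharP.cast_eq_zero, map_zero]
  rw [dOne, Derivation.leibniz_pow, ← Nat.cast_smul_eq_nsmul A, hp, zero_smul, map_zero]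

/-- In the Leibniz rule the term with `d(rᵖ)` drops out. -/
lemma extD_pow_char_smul (r : A) (x : Forms k A) :
    extD k A (r ^ p • x) = r ^ p • extD k A x := by
  rw [Algebra.smul_def, extD_mul, extD_algebraMap, dOne_pow_char, zero_mul, zero_add,
    AlgHom.commutes, ← Algebra.smul_def]

/-- Multiplication by `rᵖ` on the de Rham complex. -/
def frobMulNat (r : A) : complexNat k A ⟶ complexNat k A :=
  CochainComplex.ofHom
    (fun n => ModuleCat.ofHom
      ((LinearMap.lsmul A (⋀[A]^n (Ω[A⁄k])) (r ^ p)).restrictScalars k))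
    (fun n => by
      rw [complexNat_d]
      ext x
      refine Subtype.ext ?_
      exact extD_pow_char_smul p r x.1)

end

/-- Multiplication by `rᵖ` on the de Rham complex. -/
def frobMul (A : CommAlgCat.{u} k) (r : A) :
    (DeRham.functor k).obj A ⟶ (DeRham.functor k).obj A :=
  HomologicalComplex.extendMap (frobMulNat p r) ComplexShape.embeddingUpNat

lemma frobMul_one (A : CommAlgCat.{u} k) : frobMul p A 1 = 𝟙 _ := by
  have : frobMulNat p (1 : A) = 𝟙 (complexNat k A) := by
    ext n x
    refine Subtype.ext ?_
    change (1 : A) ^ p • x.1 = x.1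
    rw [one_pow, one_smul]
  rw [frobMul, this]
  exact HomologicalComplex.extendMap_id _ _

lemma frobMul_zero [Fact p.Prime] (A : CommAlgCat.{u} k) : frobMul p A 0 = 0 := by
  have : frobMulNat p (0 : A) = (0 : complexNat k A ⟶ complexNat k A) := by
    ext n x
    refine Subtype.ext ?_
    change (0 : A) ^ p • x.1 = 0
    rw [zero_pow (Fact.out : p.Prime).ne_zero, zero_smul]
  rw [frobMul, this]
  exact HomologicalComplex.extendMap_zero _ _ _

lemma frobMul_naturality {A B : CommAlgCat.{u} k} (f : A ⟶ B) (r : A) :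
    frobMul p A r ≫ (DeRham.functor k).map f =
      (DeRham.functor k).map f ≫ frobMul p B (f.hom r) := by
  have : frobMulNat p r ≫ (functorNat k).map f = (functorNat k).map f ≫ frobMulNat p (f.hom r) := by
    ext n x
    refine Subtype.ext ?_
    change formsMap f.hom (r ^ p • x.1) = (f.hom r) ^ p • formsMap f.hom x.1
    rw [Algebra.smul_def, map_mul, formsMap_algebraMap, map_pow, ← Algebra.smul_def]
  have h := congrArg (fun t => HomologicalComplex.extendMap t ComplexShape.embeddingUpNat) this
  exact (HomologicalComplex.extendMap_comp _ _ _).symm.trans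
    (h.trans (HomologicalComplex.extendMap_comp _ _ _))

end Frobenius

/-! ### Functions acting on the derived de Rham complex through the polynomial resolution -/

section BarAction

open Simplicial Opposite

variable (p : ℕ) {k : Type u} [Field k] [CharP k p]

/-- The difference `[b] - [0]` in the polynomial algebra on the set `A`. -/
def bracket (A : CommAlgCat.{u} k) (b : A) : (polyComonad k).obj A :=
  (MvPolynomial.X b - MvPolynomial.X 0 : MvPolynomial A k)

/-- The reason for subtracting `[0]`: the variable `[0]` is not zero in `k[A]`, and the zero
function has to act by zero strictly. -/
lemma bracket_zero (A : CommAlgCat.{u} k) : bracket A 0 = 0 :=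
  sub_self (MvPolynomial.X 0 : MvPolynomial A k)

lemma map_bracket {A B : CommAlgCat.{u} k} (f : A ⟶ B) (b : A) :
    ((polyComonad k).map f).hom (bracket A b) = bracket B (f.hom b) := by
  change MvPolynomial.rename f.hom (MvPolynomial.X b - MvPolynomial.X 0) =
    (MvPolynomial.X (f.hom b) - MvPolynomial.X 0 : MvPolynomial B k)
  rw [map_sub, MvPolynomial.rename_X, MvPolynomial.rename_X, map_zero]

lemma counit_bracket (A : CommAlgCat.{u} k) (b : A) :
    ((polyComonad k).ε.app A).hom (bracket A b) = b := by
  change MvPolynomial.aeval id (MvPolynomial.X b - MvPolynomial.X 0) = b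
  rw [map_sub, MvPolynomial.aeval_X, MvPolynomial.aeval_X, id, id, sub_zero]

/-- The simplicial de Rham complex of the standard resolution. -/
abbrev barDeRham (k : Type u) [Field k] :
    CommAlgCat.{u} k ⥤ SimplicialObject (CochainComplex (ModuleCat.{u} k) ℤ) :=
  bar (polyComonad k) ⋙ (SimplicialObject.whiskering _ _).obj (DeRham.functor k)

/-- The terms of the standard resolution. -/
abbrev resolutionTerm (A : CommAlgCat.{u} k) (n : ℕ) : CommAlgCat.{u} k :=
  iterObj (polyComonad k) A (n + 1)

/-- The `n`-simplex of the standard resolution obtained from an `l`-simplex `r` by pulling back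
along `g`. -/
def pullSimplex (A : CommAlgCat.{u} k) (l : ℕ) (r : resolutionTerm A l)
    (n : SimplexCategoryᵒᵖ) (g : n.unop ⟶ ⦋l⦌) : ((bar (polyComonad k)).obj A).obj n :=
  (iterAct (polyComonad k) A (l + 1) (n.unop.len + 1) g.toOrderHom).hom r

/-- Since the structure maps of the resolution are algebra maps, this compatibility makes levelwise
multiplication by the pullbacks of a fixed simplex a simplicial operation. -/
lemma map_pullSimplex (A : CommAlgCat.{u} k) (l : ℕ) (r : resolutionTerm A l)
    {n m : SimplexCategoryᵒᵖ} (α : n ⟶ m) (g : n.unop ⟶ ⦋l⦌) :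
    (((bar (polyComonad k)).obj A).map α).hom (pullSimplex A l r n g) =
      pullSimplex A l r m (α.unop ≫ g) := by
  have h := iterAct_comp (polyComonad k) A (l + 1) (n.unop.len + 1) (m.unop.len + 1)
    g.toOrderHom α.unop.toOrderHom
  exact (congrArg (fun t => t.hom r) h).symm

lemma pullSimplex_comp (A : CommAlgCat.{u} k) (l l' : ℕ) (r : resolutionTerm A l)
    (n : SimplexCategoryᵒᵖ) (g : n.unop ⟶ ⦋l'⦌) (g' : ⦋l'⦌ ⟶ ⦋l⦌) :
    pullSimplex A l r n (g ≫ g') = pullSimplex A l' (pullSimplex A l r (op ⦋l'⦌) g') n g :=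
  (map_pullSimplex A l r (n := op ⦋l'⦌) (m := n) g.op g').symm

lemma iterMap_pullSimplex {A B : CommAlgCat.{u} k} (f : A ⟶ B) (l : ℕ)
    (r : resolutionTerm A l) (n : SimplexCategoryᵒᵖ) (g : n.unop ⟶ ⦋l⦌) :
    (((bar (polyComonad k)).map f).app n).hom (pullSimplex A l r n g) =
      pullSimplex B l ((iterMap (polyComonad k) f (l + 1)).hom r) n g := by
  have h := iterAct_naturality (polyComonad k) f (l + 1) (n.unop.len + 1) g.toOrderHom
  exact (congrArg (fun t => t.hom r) h).symm

/-- Multiplication by `[b] - [0]` on the simplicial de Rham complex of the standard resolution. -/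
def barMul (A : CommAlgCat.{u} k) (b : A) : (barDeRham k).obj A ⟶ (barDeRham k).obj A where
  app n := frobMul p _ (pullSimplex A 0 (bracket A b) n (SimplexCategory.const _ ⦋0⦌ 0))
  naturality n m α := by
    refine Eq.trans ?_ (frobMul_naturality p _ _).symm
    rw [map_pullSimplex]
    rfl

lemma barMul_naturality {A B : CommAlgCat.{u} k} (f : A ⟶ B) (b : A) :
    barMul p A b ≫ (barDeRham k).map f = (barDeRham k).map f ≫ barMul p B (f.hom b) := by
  apply SimplicialObject.hom_ext
  intro n
  refine (frobMul_naturality p _ _).trans ?_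
  rw [iterMap_pullSimplex]
  have : (iterMap (polyComonad k) f (0 + 1)).hom (bracket A b) = bracket B (f.hom b) :=
    map_bracket f b
  rw [this]
  rfl

lemma barMul_zero [Fact p.Prime] (A : CommAlgCat.{u} k) (n : SimplexCategoryᵒᵖ) :
    (barMul p A 0).app n = 0 := by
  have : pullSimplex A 0 (bracket A 0) n (SimplexCategory.const _ ⦋0⦌ 0) = 0 := by
    rw [bracket_zero]
    exact map_zero (iterAct (polyComonad k) A 1 (n.unop.len + 1) _).hom
  change frobMul p _ _ = 0
  rw [this, frobMul_zero]

/-- The path from `[1] - [0]` to `1` in the standard resolution of `A`. -/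
def unitPath (A : CommAlgCat.{u} k) : resolutionTerm A 1 :=
  bracket ((polyComonad k).obj A) 1

lemma rename_counit_bracket (k A : Type u) [Field k] [CommRing A] [Algebra k A] :
    MvPolynomial.rename (fun x : MvPolynomial (MvPolynomial A k) k =>
      MvPolynomial.aeval (R := k) (id : A → A) (MvPolynomial.aeval (R := k) id x : MvPolynomial A k))
    (MvPolynomial.rename MvPolynomial.X (MvPolynomial.X (1 : MvPolynomial A k) -
      MvPolynomial.X (0 : MvPolynomial A k) : MvPolynomial (MvPolynomial A k) k)) =
      (MvPolynomial.X 1 - MvPolynomial.X 0 : MvPolynomial A k) := by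
  simp only [map_sub, MvPolynomial.rename_X, MvPolynomial.aeval_X, id, map_one, map_zero]

/-- This face applies the counit inside the outer brackets, `[x] ↦ [ε x]`, and `ε` fixes `0` and
`1`. -/
lemma unitPath_zero (A : CommAlgCat.{u} k) :
    pullSimplex A 1 (unitPath A) (op ⦋0⦌) (SimplexCategory.const ⦋0⦌ ⦋1⦌ 0) = bracket A 1 := by
  have h0 : ∀ α : Fin 0 →o Fin 2, iterAct (polyComonad k) A 2 0 α =
      (polyComonad k).ε.app ((polyComonad k).obj A) ≫ (polyComonad k).ε.app A := fun α => by
    rw [iterAct_skip _ _ _ _ _ (fun i => i.elim0), iterAct_skip _ _ _ _ _ (fun i => i.elim0),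
      iterAct]
    exact congrArg (_ ≫ ·) (Category.comp_id _)
  -- The recursion for `iterAct` produces the face as a comultiplication followed by two counits
  -- under the functor, rather than as `(polyComonad k).map` of one counit.
  have h1 : iterAct (polyComonad k) A 2 1 (SimplexCategory.const ⦋0⦌ ⦋1⦌ 0).toOrderHom =
      (polyComonad k).δ.app ((polyComonad k).obj A) ≫ (polyComonad k).map
        ((polyComonad k).ε.app ((polyComonad k).obj A) ≫ (polyComonad k).ε.app A) := by
    rw [← h0 (dropSource (SimplexCategory.const ⦋0⦌ ⦋1⦌ 0).toOrderHom)]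
    exact iterAct_hit _ _ _ _ _ rfl
  refine (congrArg (fun t => t.hom (unitPath A)) h1).trans ?_
  exact rename_counit_bracket k A

/-- This face removes the outer brackets, `[x] ↦ x`, so that `[1] - [0]` becomes `1 - 0`. -/
lemma unitPath_one (A : CommAlgCat.{u} k) :
    pullSimplex A 1 (unitPath A) (op ⦋0⦌) (SimplexCategory.const ⦋0⦌ ⦋1⦌ 1) = 1 := by
  have h : iterAct (polyComonad k) A 2 1 (SimplexCategory.const ⦋0⦌ ⦋1⦌ 1).toOrderHom =
      (polyComonad k).ε.app ((polyComonad k).obj A) := by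
    have hne : ∀ i, (SimplexCategory.const ⦋0⦌ ⦋1⦌ 1).toOrderHom i ≠ 0 := fun i => one_ne_zero
    have hid : dropTarget (SimplexCategory.const ⦋0⦌ ⦋1⦌ 1).toOrderHom hne = OrderHom.id :=
      OrderHom.ext _ _ (funext fun i => Subsingleton.elim _ _)
    refine (iterAct_skip _ _ _ _ _ hne).trans ?_
    rw [hid]
    exact (congrArg (_ ≫ ·) (iterAct_id (polyComonad k) A 1)).trans (Category.comp_id _)
  exact (congrArg (fun t => t.hom (unitPath A)) h).trans
    (counit_bracket ((polyComonad k).obj A) 1)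

/-- The action of the interval through the path from `[1] - [0]` to `1`. -/
def barAction (A : CommAlgCat.{u} k) : IntervalAction ((barDeRham k).obj A) where
  act n g := frobMul p _ (pullSimplex A 1 (unitPath A) n g)
  naturality {n m} α g := by
    refine Eq.trans ?_ (frobMul_naturality p _ _).symm
    rw [map_pullSimplex]
    rfl

lemma barAction_vertex_zero (A : CommAlgCat.{u} k) : (barAction p A).vertex 0 = barMul p A 1 := by
  apply SimplicialObject.hom_ext
  intro n
  refine congrArg (frobMul p _) ?_
  rw [← unitPath_zero, ← pullSimplex_comp]
  rfl

lemma barAction_vertex_one (A : CommAlgCat.{u} k) : (barAction p A).vertex 1 = 𝟙 _ := by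
  apply SimplicialObject.hom_ext
  intro n
  refine Eq.trans (congrArg (frobMul p _) ?_) (frobMul_one p _)
  refine (pullSimplex_comp A 1 0 (unitPath A) n (SimplexCategory.const _ ⦋0⦌ 0)
    (SimplexCategory.const ⦋0⦌ ⦋1⦌ 1)).trans ?_
  rw [unitPath_one]
  exact map_one (iterAct (polyComonad k) A 1 (n.unop.len + 1) _).hom

/-- Multiplication by `[b] - [0]` on the derived de Rham complex of `A`. -/
def discMul (A : CommAlgCat.{u} k) (b : A) :
    (derivedDeRhamDiscrete k).obj A ⟶ (derivedDeRhamDiscrete k).obj A :=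
  (realization k).map (barMul p A b)

lemma discMul_naturality {A B : CommAlgCat.{u} k} (f : A ⟶ B) (b : A) :
    discMul p A b ≫ (derivedDeRhamDiscrete k).map f =
      (derivedDeRhamDiscrete k).map f ≫ discMul p B (f.hom b) := by
  refine ((realization k).map_comp _ _).symm.trans (Eq.trans ?_ ((realization k).map_comp _ _))
  exact congrArg (realization k).map (barMul_naturality p f b)

lemma discMul_zero [Fact p.Prime] (A : CommAlgCat.{u} k) : discMul p A 0 = 0 :=
  realization_map_eq_zero _ (barMul_zero p A)

lemma quasiIso_of_homotopy {K L : CochainComplex (ModuleCat.{u} k) ℤ} {f g : K ⟶ L}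
    (H : Homotopy f g) (hg : QuasiIso g) : QuasiIso f := by
  rw [quasiIso_iff] at hg ⊢
  intro i
  rw [quasiIsoAt_iff_isIso_homologyMap, H.homologyMap_eq, ← quasiIsoAt_iff_isIso_homologyMap]
  exact hg i

lemma quasiIso_id (K : CochainComplex (ModuleCat.{u} k) ℤ) : QuasiIso (𝟙 K) := inferInstance

/-- The element `[1] - [0]` is not `1`, but `unitPath` joins them, and multiplication by the `p`-th
powers of its pullbacks is a homotopy to the identity. -/
lemma quasiIso_discMul_one (A : CommAlgCat.{u} k) : QuasiIso (discMul p A 1) := by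
  have H := realizationHomotopy (barAction p A).homotopy
  rw [barAction_vertex_zero, barAction_vertex_one, CategoryTheory.Functor.map_id] at H
  exact quasiIso_of_homotopy H (quasiIso_id _)

end BarAction

/-! ### Acyclicity of the Suslin complex of the derived de Rham complex -/

section SuslinAcyclic

open Simplicial Opposite

variable (p : ℕ) {k : Type u} [Field k] [CharP k p]

/-- On homology `f` is both zero and an isomorphism. -/
lemma acyclic_of_homotopy_zero {K : CochainComplex (ModuleCat.{u} k) ℤ} {f : K ⟶ K}
    (H : Homotopy f 0) (hf : QuasiIso f) : K.Acyclic := by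
  intro i
  rw [HomologicalComplex.exactAt_iff_isZero_homology]
  have h1 : HomologicalComplex.homologyMap f i = 0 := by
    rw [H.homologyMap_eq, HomologicalComplex.homologyMap_zero]
  have h2 : IsIso (HomologicalComplex.homologyMap f i) := inferInstance
  rw [h1] at h2
  rw [Limits.IsZero.iff_id_eq_zero]
  exact (cancel_mono (0 : K.homology i ⟶ K.homology i)).mp (by simp)

/-- The algebra `S_q ⊗ k[Δᵐ]`. -/
abbrev simplexExtTerm (S : SCAlg k) (m q : SimplexCategoryᵒᵖ) : CommAlgCat.{u} k :=
  (((simplexExt k).obj S).obj m).obj q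

/-- The element of `S_q ⊗ k[Δᵐ]` given by a function on the affine simplex. -/
def simplexElement (S : SCAlg k) (m q : SimplexCategoryᵒᵖ) (b : SimplexRing k m.unop.len) :
    simplexExtTerm S m q :=
  (1 : S.obj q) ⊗ₜ[k] b

/-- Multiplication by `[b] - [0]` on the derived de Rham complex of `S[Δᵐ]`, for a function `b` on
the affine simplex. -/
def simplexMul (S : SCAlg k) (m : SimplexCategoryᵒᵖ) (b : SimplexRing k m.unop.len) :
    (derivedDeRham k).obj (((simplexExt k).obj S).obj m) ⟶
      (derivedDeRham k).obj (((simplexExt k).obj S).obj m) :=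
  (realization k).map
    { app := fun q => discMul p _ (simplexElement S m q b)
      naturality := fun q r α => by
        refine Eq.trans ?_ (discMul_naturality p _ _).symm
        have : ((((simplexExt k).obj S).obj m).map α).hom (simplexElement S m q b) =
            simplexElement S m r b := by
          refine (Algebra.TensorProduct.map_tmul _ _ _ _).trans ?_
          rw [map_one]; rfl
        rw [this]
        rfl }

lemma simplexMul_naturality (S : SCAlg k) {m l : SimplexCategoryᵒᵖ} (α : m ⟶ l)
    (b : SimplexRing k m.unop.len) :
    simplexMul p S m b ≫ (derivedDeRham k).map (((simplexExt k).obj S).map α) =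
      (derivedDeRham k).map (((simplexExt k).obj S).map α) ≫
        simplexMul p S l (simplexRingMap α.unop.toOrderHom b) := by
  refine ((realization k).map_comp _ _).symm.trans (Eq.trans ?_ ((realization k).map_comp _ _))
  refine congrArg (realization k).map ?_
  apply SimplicialObject.hom_ext
  intro q
  refine (discMul_naturality p _ _).trans ?_
  have : ((((simplexExt k).obj S).map α).app q).hom (simplexElement S m q b) =
      simplexElement S l q (simplexRingMap α.unop.toOrderHom b) :=
    Algebra.TensorProduct.map_tmul _ _ _ _
  rw [this]
  rfl

lemma simplexMul_zero [Fact p.Prime] (S : SCAlg k) (m : SimplexCategoryᵒᵖ) :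
    simplexMul p S m 0 = 0 := by
  refine realization_map_eq_zero _ fun q => ?_
  refine Eq.trans ?_ (discMul_zero p _)
  exact congrArg (discMul p _) (TensorProduct.tmul_zero _ _)

lemma quasiIso_simplexMul_one (S : SCAlg k) (m : SimplexCategoryᵒᵖ) :
    QuasiIso (simplexMul p S m 1) :=
  quasiIso_realization_map _ fun _ => quasiIso_discMul_one p _

/-- The function on the affine `n`-simplex that pulls back the second coordinate of the line. -/
def pullCoord (k : Type u) [Field k] {n : SimplexCategory} (g : n ⟶ ⦋1⦌) : SimplexRing k n.len :=
  simplexRingMap g.toOrderHom (coord k 1 1)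

lemma pullCoord_comp {n m : SimplexCategory} (f : m ⟶ n) (g : n ⟶ ⦋1⦌) :
    simplexRingMap f.toOrderHom (pullCoord k g) = pullCoord k (f ≫ g) := by
  have h := (affineSimplex k).map_comp g.op f.op
  exact (congrArg (fun t => t.hom (coord k 1 1)) h).symm

lemma pullCoord_zero (n : SimplexCategory) :
    pullCoord k (SimplexCategory.const n ⦋1⦌ 0) = 0 := by
  refine (simplexRingMap_coord _ _).trans (Finset.sum_eq_zero fun i hi => ?_)
  exact absurd (Finset.mem_filter.mp hi).2 zero_ne_one

/-- All vertices lie over `1`, so the pullback is the sum of all barycentric coordinates. -/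
lemma pullCoord_one (n : SimplexCategory) :
    pullCoord k (SimplexCategory.const n ⦋1⦌ 1) = 1 := by
  refine (simplexRingMap_coord _ _).trans (Eq.trans ?_ (sum_coord k n.len))
  exact Finset.sum_congr (Finset.filter_true_of_mem fun i _ => rfl) fun _ _ => rfl

/-- The simplicial complex `[m] ↦ LΩ(S[Δᵐ])`. -/
abbrev suslinDeRham (S : SCAlg k) : SimplicialObject (CochainComplex (ModuleCat.{u} k) ℤ) :=
  ((SimplicialObject.whiskering _ _).obj (derivedDeRham k)).obj ((simplexExt k).obj S)

/-- The action of the interval on `[m] ↦ LΩ(S[Δᵐ])` through the coordinate of the affine line. -/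
def suslinAction (S : SCAlg k) : IntervalAction (suslinDeRham S) where
  act n g := simplexMul p S n (pullCoord k g)
  naturality {n m} α g := by
    refine Eq.trans ?_ (simplexMul_naturality p S α _).symm
    rw [pullCoord_comp]
    rfl

/-- The two ends of `suslinAction` are multiplication by the functions `0` and `1`. The first is the
zero map, the second a quasi-isomorphism in each simplicial degree, and they are homotopic after
realization. -/
theorem acyclic_suslin_derivedDeRham [Fact p.Prime] (S : SCAlg k) :
    ((suslin k (derivedDeRham k)).obj S).Acyclic := by
  have h0 : (realization k).map ((suslinAction p S).vertex 0) = 0 :=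
    realization_map_eq_zero _ fun n => by
      refine Eq.trans ?_ (simplexMul_zero p S n)
      exact congrArg (simplexMul p S n) (pullCoord_zero n.unop)
  have h1 : QuasiIso ((realization k).map ((suslinAction p S).vertex 1)) :=
    quasiIso_realization_map _ fun n => by
      have h : ((suslinAction p S).vertex 1).app n = simplexMul p S n 1 :=
        congrArg (simplexMul p S n) (pullCoord_one n.unop)
      rw [h]
      exact quasiIso_simplexMul_one p S n
  have H := (realizationHomotopy (suslinAction p S).homotopy).symm
  rw [h0] at H
  exact acyclic_of_homotopy_zero H h1

end SuslinAcyclic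

/-! ### The linear contraction of the affine simplex -/

section LinearHomotopy

variable {k : Type u} [Field k]

/-- The contraction `T_j ↦ t T_j + (1 - t) δ_{j0}` of the affine simplex to a vertex, composed with
a map to an algebra `B`. -/
def coneHom {B : Type u} [CommRing B] [Algebra k B] {n : ℕ} (x : SimplexRing k n →ₐ[k] B) :
    SimplexRing k n →ₐ[k] Polynomial B :=
  Ideal.Quotient.liftₐ _ (MvPolynomial.aeval (fun j =>
    Polynomial.C (x (coord k n j)) * Polynomial.X + if j = 0 then 1 - Polynomial.X else 0)) (by
    intro a ha
    rw [← RingHom.mem_ker]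
    refine (Ideal.span_le (I := RingHom.ker (MvPolynomial.aeval _ : _ →ₐ[k] _))).mpr ?_ ha
    rw [Set.singleton_subset_iff]
    simp only [SetLike.mem_coe, RingHom.mem_ker, map_sub, map_sum, MvPolynomial.aeval_X, map_one]
    rw [Finset.sum_add_distrib, ← Finset.sum_mul, ← map_sum, ← map_sum, sum_coord, map_one,
      map_one, Finset.sum_ite_eq' Finset.univ (0 : Fin (n + 1)), if_pos (Finset.mem_univ _)]
    -- The images of the coordinates sum to `t + (1 - t) = 1`.
    ring)

lemma coneHom_coord {B : Type u} [CommRing B] [Algebra k B] {n : ℕ}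
    (x : SimplexRing k n →ₐ[k] B) (j : Fin (n + 1)) :
    coneHom x (coord k n j) =
      Polynomial.C (x (coord k n j)) * Polynomial.X + if j = 0 then 1 - Polynomial.X else 0 :=
  MvPolynomial.aeval_X _ _

/-- The evaluation at a vertex of the affine simplex. -/
def vertexHom (k : Type u) [Field k] (n : ℕ) : SimplexRing k n →ₐ[k] k :=
  Ideal.Quotient.liftₐ _ (MvPolynomial.aeval (fun j => if j = 0 then 1 else 0)) (by
    intro a ha
    rw [← RingHom.mem_ker]
    refine (Ideal.span_le (I := RingHom.ker (MvPolynomial.aeval _ : _ →ₐ[k] _))).mpr ?_ ha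
    rw [Set.singleton_subset_iff]
    simp only [SetLike.mem_coe, RingHom.mem_ker, map_sub, map_sum, MvPolynomial.aeval_X, map_one]
    rw [Finset.sum_ite_eq' Finset.univ (0 : Fin (n + 1)), if_pos (Finset.mem_univ _), sub_self])

lemma vertexHom_coord (n : ℕ) (j : Fin (n + 1)) :
    vertexHom k n (coord k n j) = if j = 0 then 1 else 0 :=
  MvPolynomial.aeval_X _ _

/-- The evaluation `B[t] → B` at a constant. -/
def evalHom (B : Type u) [CommRing B] [Algebra k B] (c : k) : Polynomial B →ₐ[k] B :=
  (Polynomial.aeval (algebraMap k B c) : Polynomial B →ₐ[B] B).restrictScalars k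

lemma evalHom_C {B : Type u} [CommRing B] [Algebra k B] (c : k) (b : B) :
    evalHom B c (Polynomial.C b) = b :=
  Polynomial.aeval_C _ _

lemma evalHom_X {B : Type u} [CommRing B] [Algebra k B] (c : k) :
    evalHom B c Polynomial.X = algebraMap k B c :=
  Polynomial.aeval_X _

lemma evalHom_mapAlgHom {A B : Type u} [CommRing A] [Algebra k A] [CommRing B] [Algebra k B]
    (c : k) (φ : A →ₐ[k] B) (f : Polynomial A) :
    evalHom B c (Polynomial.mapAlgHom φ f) = φ (evalHom A c f) := by
  induction f using Polynomial.induction_on' with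
  | add f g hf hg => simp only [map_add, hf, hg]
  | monomial n a =>
    rw [← Polynomial.C_mul_X_pow_eq_monomial]
    simp only [map_mul, map_pow, evalHom_C, evalHom_X, AlgHom.commutes,
      Polynomial.map_C, Polynomial.map_X,
      Polynomial.coe_mapAlgHom, RingHom.coe_coe]

section Tensor

variable {A B : Type u} [CommRing A] [Algebra k A] [CommRing B] [Algebra k B] {n : ℕ}

lemma tensorSimplex_hom_ext {f g : TensorProduct k A (SimplexRing k n) →ₐ[k] B}
    (h₁ : ∀ a, f (a ⊗ₜ 1) = g (a ⊗ₜ 1)) (h₂ : ∀ j, f (1 ⊗ₜ coord k n j) = g (1 ⊗ₜ coord k n j)) :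
    f = g := by
  have h : f.comp Algebra.TensorProduct.includeRight =
      g.comp Algebra.TensorProduct.includeRight := simplexRing_hom_ext h₂
  apply Algebra.TensorProduct.ext'
  intro a b
  have e : a ⊗ₜ[k] b = a ⊗ₜ[k] (1 : SimplexRing k n) * (1 : A) ⊗ₜ[k] b := by
    rw [Algebra.TensorProduct.tmul_mul_tmul, mul_one, one_mul]
  rw [e, map_mul, map_mul, h₁]
  exact congrArg _ (DFunLike.congr_fun h b)

variable (k A n) in
/-- The evaluation `A[Δⁿ] → A` at a vertex. -/
def tensorVertex : TensorProduct k A (SimplexRing k n) →ₐ[k] A :=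
  Algebra.TensorProduct.lift (AlgHom.id k A)
    ((Algebra.ofId k A).comp (vertexHom k n)) (fun _ _ => Commute.all _ _)

lemma tensorVertex_left (a : A) : tensorVertex k A n (a ⊗ₜ 1) = a := by
  rw [tensorVertex, Algebra.TensorProduct.lift_tmul, map_one, mul_one]
  rfl

lemma tensorVertex_coord (j : Fin (n + 1)) :
    tensorVertex k A n (1 ⊗ₜ coord k n j) = if j = 0 then 1 else 0 := by
  rw [tensorVertex, Algebra.TensorProduct.lift_tmul, map_one, one_mul, AlgHom.comp_apply,
    vertexHom_coord]
  split_ifs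
  · exact map_one _
  · exact map_zero _

/-- The linear contraction of the affine simplex, as a map `A[Δⁿ] → B[t]`. -/
def tensorCone (i : A →ₐ[k] B) (x : SimplexRing k n →ₐ[k] B) :
    TensorProduct k A (SimplexRing k n) →ₐ[k] Polynomial B :=
  Algebra.TensorProduct.lift
    (((Polynomial.CAlgHom (R := B) (A := B)).restrictScalars k).comp i)
    (coneHom x) (fun _ _ => Commute.all _ _)

variable (i : A →ₐ[k] B) (x : SimplexRing k n →ₐ[k] B)

lemma tensorCone_left (a : A) : tensorCone i x (a ⊗ₜ 1) = Polynomial.C (i a) := by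
  rw [tensorCone, Algebra.TensorProduct.lift_tmul, map_one, mul_one]
  rfl

lemma tensorCone_coord (j : Fin (n + 1)) :
    tensorCone i x (1 ⊗ₜ coord k n j) =
      Polynomial.C (x (coord k n j)) * Polynomial.X + if j = 0 then 1 - Polynomial.X else 0 := by
  rw [tensorCone, Algebra.TensorProduct.lift_tmul, map_one, one_mul, coneHom_coord]

lemma tensorCone_naturality {A' B' : Type u} [CommRing A'] [Algebra k A'] [CommRing B']
    [Algebra k B'] {i' : A' →ₐ[k] B'} {x' : SimplexRing k n →ₐ[k] B'} (f : A →ₐ[k] A')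
    (g : B →ₐ[k] B') (hi : g.comp i = i'.comp f) (hx : g.comp x = x') :
    (tensorCone i' x').comp (Algebra.TensorProduct.map f (AlgHom.id k (SimplexRing k n))) =
      (Polynomial.mapAlgHom g).comp (tensorCone i x) := by
  subst hx
  apply tensorSimplex_hom_ext
  · intro a
    rw [AlgHom.comp_apply, AlgHom.comp_apply, Algebra.TensorProduct.map_tmul, map_one,
      tensorCone_left, tensorCone_left, Polynomial.coe_mapAlgHom, Polynomial.map_C,
      RingHom.coe_coe]
    exact congrArg Polynomial.C (DFunLike.congr_fun hi a).symm
  · intro j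
    rw [AlgHom.comp_apply, AlgHom.comp_apply, Algebra.TensorProduct.map_tmul, map_one,
      AlgHom.id_apply, tensorCone_coord, tensorCone_coord, map_add, map_mul,
      Polynomial.coe_mapAlgHom, Polynomial.map_C, Polynomial.map_X, RingHom.coe_coe]
    split_ifs
    · simp
    · simp

/-- The end `t = 1` of the contraction; for `B = A[Δⁿ]` with its canonical maps it is the identity.
-/
lemma evalHom_one_tensorCone {φ : TensorProduct k A (SimplexRing k n) →ₐ[k] B}
    (h₁ : ∀ a, φ (a ⊗ₜ 1) = i a) (h₂ : ∀ j, φ (1 ⊗ₜ coord k n j) = x (coord k n j)) :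
    (evalHom B (1 : k)).comp (tensorCone i x) = φ := by
  apply tensorSimplex_hom_ext
  · intro a
    rw [AlgHom.comp_apply, tensorCone_left, evalHom_C, h₁]
  · intro j
    rw [AlgHom.comp_apply, tensorCone_coord, map_add, map_mul, evalHom_C, evalHom_X, map_one,
      mul_one, h₂]
    split_ifs
    · rw [map_sub, evalHom_X, map_one, map_one, sub_self, add_zero]
    · rw [map_zero, add_zero]

/-- The end `t = 0` of the contraction: every coordinate becomes its value at the vertex. -/
lemma evalHom_zero_tensorCone :
    (evalHom B (0 : k)).comp (tensorCone i x) = i.comp (tensorVertex k A n) := by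
  apply tensorSimplex_hom_ext
  · intro a
    rw [AlgHom.comp_apply, tensorCone_left, evalHom_C, AlgHom.comp_apply, tensorVertex_left]
  · intro j
    rw [AlgHom.comp_apply, tensorCone_coord, map_add, map_mul, evalHom_C, evalHom_X, map_zero,
      mul_zero, zero_add, AlgHom.comp_apply, tensorVertex_coord]
    split_ifs
    · rw [map_sub, evalHom_X, map_zero, sub_zero, map_one, map_one]
    · rw [map_zero, map_zero]

end Tensor

variable (S : SCAlg k) (m : SimplexCategoryᵒᵖ)

/-- The inclusion `S → S[Δᵐ]`. -/
def simplexIncl : S ⟶ ((simplexExt k).obj S).obj m where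
  app q := CommAlgCat.ofHom Algebra.TensorProduct.includeLeft
  naturality q r α := by
    ext : 1
    apply AlgHom.ext
    intro a
    change (S.map α).hom a ⊗ₜ[k] (1 : SimplexRing k m.unop.len) =
      Algebra.TensorProduct.map (S.map α).hom (AlgHom.id k _) (a ⊗ₜ[k] 1)
    rw [Algebra.TensorProduct.map_tmul, map_one]

/-- The evaluation `S[Δᵐ] → S` at a vertex. -/
def simplexVertex : ((simplexExt k).obj S).obj m ⟶ S where
  app q := CommAlgCat.ofHom (tensorVertex k (S.obj q) m.unop.len)
  naturality q r α := by
    ext : 1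
    have h : (tensorVertex k (S.obj r) m.unop.len).comp
        (Algebra.TensorProduct.map (S.map α).hom (AlgHom.id k (SimplexRing k m.unop.len))) =
          (S.map α).hom.comp (tensorVertex k (S.obj q) m.unop.len) := by
      apply tensorSimplex_hom_ext
      · intro a
        rw [AlgHom.comp_apply, AlgHom.comp_apply, Algebra.TensorProduct.map_tmul, map_one,
          tensorVertex_left, tensorVertex_left]
      · intro j
        rw [AlgHom.comp_apply, AlgHom.comp_apply, Algebra.TensorProduct.map_tmul, map_one,
          AlgHom.id_apply, tensorVertex_coord, tensorVertex_coord, apply_ite (S.map α).hom,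
          map_one, map_zero]
    exact h

lemma simplexIncl_vertex : simplexIncl S m ≫ simplexVertex S m = 𝟙 S := by
  apply SimplicialObject.hom_ext
  intro q
  ext : 1
  apply AlgHom.ext
  intro a
  exact tensorVertex_left a

/-- The functor `S ↦ S[t]` on simplicial commutative algebras. -/
abbrev lineExt (T : SCAlg k) : SCAlg k := ((SimplicialObject.whiskering _ _).obj (polyExt k)).obj T

/-- The evaluation `T[t] → T` at a constant. -/
def lineEval (T : SCAlg k) (c : k) : lineExt T ⟶ T where
  app q := CommAlgCat.ofHom (evalHom (T.obj q) c)
  naturality q r α := by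
    ext : 1
    apply AlgHom.ext
    intro f
    exact evalHom_mapAlgHom c (T.map α).hom f

lemma toAffineLine_lineEval (T : SCAlg k) (c : k) : toAffineLine T ≫ lineEval T c = 𝟙 T := by
  apply SimplicialObject.hom_ext
  intro q
  ext : 1
  apply AlgHom.ext
  intro a
  exact evalHom_C c a

/-- The map `k[Δᵐ] → S[Δᵐ]`. -/
def coordIncl (q : SimplexCategoryᵒᵖ) :
    SimplexRing k m.unop.len →ₐ[k] (((simplexExt k).obj S).obj m).obj q :=
  Algebra.TensorProduct.includeRight (A := S.obj q)

/-- The linear contraction of the affine simplex, as a map `S[Δᵐ] → S[Δᵐ][t]`. -/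
def simplexCone : ((simplexExt k).obj S).obj m ⟶ lineExt (((simplexExt k).obj S).obj m) where
  app q := CommAlgCat.ofHom (tensorCone ((simplexIncl S m).app q).hom (coordIncl S m q))
  naturality q r α := by
    ext : 1
    refine tensorCone_naturality _ _ (S.map α).hom ((((simplexExt k).obj S).obj m).map α).hom
      ?_ ?_
    · exact congrArg CommAlgCat.Hom.hom ((simplexIncl S m).naturality α).symm
    · apply AlgHom.ext
      intro a
      refine (Algebra.TensorProduct.map_tmul _ _ _ _).trans ?_
      rw [map_one]
      rfl

/-- The contraction is constant on scalars from `S`. It is therefore a map of `R`-algebras whenever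
`S` is one, as its use for presheaves under `R` requires. -/
lemma simplexIncl_cone :
    simplexIncl S m ≫ simplexCone S m = simplexIncl S m ≫ toAffineLine _ := by
  apply SimplicialObject.hom_ext
  intro q
  ext : 1
  apply AlgHom.ext
  intro a
  exact tensorCone_left _ _ a

lemma simplexCone_one : simplexCone S m ≫ lineEval _ 1 = 𝟙 _ := by
  apply SimplicialObject.hom_ext
  intro q
  ext : 1
  exact evalHom_one_tensorCone (A := S.obj q) ((simplexIncl S m).app q).hom (coordIncl S m q)
    (φ := AlgHom.id k ((((simplexExt k).obj S).obj m).obj q)) (fun _ => rfl) (fun _ => rfl)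

lemma simplexCone_zero :
    simplexCone S m ≫ lineEval _ 0 = simplexVertex S m ≫ simplexIncl S m := by
  apply SimplicialObject.hom_ext
  intro q
  ext : 1
  exact evalHom_zero_tensorCone _ _

lemma simplexIncl_map {m l : SimplexCategoryᵒᵖ} (α : m ⟶ l) :
    simplexIncl S m ≫ ((simplexExt k).obj S).map α = simplexIncl S l := by
  apply SimplicialObject.hom_ext
  intro q
  ext : 1
  apply AlgHom.ext
  intro a
  refine (Algebra.TensorProduct.map_tmul _ _ _ _).trans ?_
  rw [map_one]
  rfl

lemma simplexIncl_naturality {S T : SCAlg k} (f : S ⟶ T) (m : SimplexCategoryᵒᵖ) :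
    simplexIncl S m ≫ ((simplexExt k).map f).app m = f ≫ simplexIncl T m := by
  apply SimplicialObject.hom_ext
  intro q
  ext : 1
  apply AlgHom.ext
  intro a
  refine (Algebra.TensorProduct.map_tmul _ _ _ _).trans ?_
  rw [map_one]
  rfl

end LinearHomotopy

/-! ### Invariant presheaves on affine simplices -/

section PshSuslin

open Opposite

variable {k : Type u} [Field k] (R : SCAlg k)

/-- The functor `S ↦ S[Δ^•]` on simplicial commutative `R`-algebras. -/
def simplexUnder : Under R ⥤ SimplicialObject (Under R) where
  obj S :=
    { obj := fun m => Under.mk (S.hom ≫ simplexIncl S.right m)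
      map := fun α => Under.homMk (((simplexExt k).obj S.right).map α) (by
        change (S.hom ≫ simplexIncl S.right _) ≫ _ = S.hom ≫ simplexIncl S.right _
        rw [Category.assoc, simplexIncl_map])
      map_id := fun m => by
        ext : 1
        exact ((simplexExt k).obj S.right).map_id m
      map_comp := fun α β => by
        ext : 1
        exact ((simplexExt k).obj S.right).map_comp α β }
  map f :=
    { app := fun m => Under.homMk (((simplexExt k).map f.right).app m) (by
        change (_ ≫ simplexIncl _ m) ≫ _ = _ ≫ simplexIncl _ m
        rw [Category.assoc, simplexIncl_naturality, Under.w_assoc])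
      naturality := fun m l α => by
        ext : 1
        exact ((simplexExt k).map f.right).naturality α }
  map_id S := by
    apply SimplicialObject.hom_ext
    intro m
    ext : 1
    exact congrArg (fun t => NatTrans.app t m) ((simplexExt k).map_id S.right)
  map_comp f g := by
    apply SimplicialObject.hom_ext
    intro m
    ext : 1
    exact congrArg (fun t => NatTrans.app t m) ((simplexExt k).map_comp f.right g.right)

/-- The map `S → S[Δᵐ]` of simplicial commutative `R`-algebras. -/
def underIncl (S : Under R) (m : SimplexCategoryᵒᵖ) : S ⟶ ((simplexUnder R).obj S).obj m :=
  Under.homMk (simplexIncl S.right m)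

variable {R}

/-- The evaluation `v` at a vertex is a retraction of `S → S[Δᵐ]`, and the linear contraction `c` is
an `𝔸¹`-homotopy from the other composite to the identity. Invariance turns `𝔸¹`-homotopic maps into
equal maps on homology. -/
lemma quasiIso_map_underIncl {G : Psh R} (hG : IsA1Invariant G) (S : Under R)
    (m : SimplexCategoryᵒᵖ) : QuasiIso (G.map (underIncl R S m)) := by
  let T := ((simplexUnder R).obj S).obj m
  let v : T ⟶ S := Under.homMk (simplexVertex S.right m) (by
    change (S.hom ≫ simplexIncl S.right m) ≫ simplexVertex S.right m = S.hom
    rw [Category.assoc, simplexIncl_vertex, Category.comp_id])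
  let c : T ⟶ Under.mk (T.hom ≫ toAffineLine T.right) := Under.homMk (simplexCone S.right m) (by
    change (S.hom ≫ simplexIncl S.right m) ≫ simplexCone S.right m =
      (S.hom ≫ simplexIncl S.right m) ≫ toAffineLine _
    rw [Category.assoc, simplexIncl_cone, Category.assoc])
  let e (x : k) : Under.mk (T.hom ≫ toAffineLine T.right) ⟶ T :=
    Under.homMk (lineEval T.right x) (by
      change (T.hom ≫ toAffineLine T.right) ≫ lineEval T.right x = T.hom
      rw [Category.assoc, toAffineLine_lineEval, Category.comp_id])
  have h1 : underIncl R S m ≫ v = 𝟙 S := by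
    ext : 1
    exact simplexIncl_vertex S.right m
  have h2 : ∀ x, underToAffineLine R T ≫ e x = 𝟙 T := fun x => by
    ext : 1
    exact toAffineLine_lineEval T.right x
  have h3 : c ≫ e 1 = 𝟙 T := by
    ext : 1
    exact simplexCone_one S.right m
  have h4 : c ≫ e 0 = v ≫ underIncl R S m := by
    ext : 1
    exact simplexCone_zero S.right m
  rw [quasiIso_iff]
  intro i
  rw [quasiIsoAt_iff_isIso_homologyMap]
  let Φ : Under R ⥤ ModuleCat.{u} k := G ⋙ HomologicalComplex.homologyFunctor _ _ i
  have hl : IsIso (Φ.map (underToAffineLine R T)) := by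
    have := hG.affineLine T
    change IsIso (HomologicalComplex.homologyMap (G.map (underToAffineLine R T)) i)
    infer_instance
  -- Both evaluations `T[t] → T` are left inverse to `T → T[t]`, which `Φ` inverts.
  have he : Φ.map (e 0) = Φ.map (e 1) := by
    rw [← cancel_epi (Φ.map (underToAffineLine R T)), ← Φ.map_comp, ← Φ.map_comp, h2, h2]
  change IsIso (Φ.map (underIncl R S m))
  refine ⟨Φ.map v, ?_, ?_⟩
  · rw [← Φ.map_comp, h1, Φ.map_id]
  · rw [← Φ.map_comp, ← h4, Φ.map_comp, he, ← Φ.map_comp, h3, Φ.map_id]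

end PshSuslin

/-! ### Maps out of zero and endofunctors in a localization -/

section Localization

variable {C : Type*} [Category C] {W : MorphismProperty C}

/-- The image of a zero object in a localization is initial. -/
lemma subsingleton_hom_of_isZero {Z : C} (hZ : Limits.IsZero Z) (Y : W.Localization) :
    Subsingleton (W.Q.obj Z ⟶ Y) := by
  let σ : (Functor.const C).obj Z ⟶ 𝟭 C :=
    { app := fun X => hZ.to_ X
      naturality := fun _ _ _ => hZ.eq_of_src _ _ }
  let : Localization.Lifting W.Q W ((Functor.const C).obj Z ⋙ W.Q)
      ((Functor.const W.Localization).obj (W.Q.obj Z)) :=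
    ⟨NatIso.ofComponents (fun _ => Iso.refl _)⟩
  let : Localization.Lifting W.Q W (𝟭 C ⋙ W.Q) (𝟭 W.Localization) := ⟨Iso.refl _⟩
  let τ : (Functor.const W.Localization).obj (W.Q.obj Z) ⟶ 𝟭 W.Localization :=
    Localization.liftNatTrans W.Q W ((Functor.const C).obj Z ⋙ W.Q) (𝟭 C ⋙ W.Q) _ _
      (Functor.whiskerRight σ W.Q)
  have hτ : τ.app (W.Q.obj Z) = 𝟙 (W.Q.obj Z) := by
    refine (Localization.liftNatTrans_app W.Q W _ _ _ _ _ _).trans ?_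
    change 𝟙 _ ≫ W.Q.map (σ.app Z) ≫ 𝟙 _ = 𝟙 _
    rw [Category.id_comp, Category.comp_id, hZ.eq_of_src (σ.app Z) (𝟙 Z)]
    exact W.Q.map_id Z
  -- The maps from `Z` to all objects descend to a natural transformation `τ` on the localization
  -- that is the identity at `Z`. Naturality at `f` then leaves no choice for `f`.
  have h (f : W.Q.obj Z ⟶ Y) : f = τ.app Y := by
    have := τ.naturality f
    rw [hτ] at this
    exact (Category.id_comp f).symm.trans (this.symm.trans (Category.id_comp _))
  exact ⟨fun f g => (h f).trans (h g).symm⟩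

/-- Both `E` and `ι` descend to the localization. By naturality, `f` followed by the map from `G` to
`E G` factors as the map from `X` to `E X` followed by the image of `f`. That image is unique by
`hX`, and the mono from `G` can be cancelled. -/
lemma subsingleton_hom_of_endofunctor (E : C ⥤ C) (hE : W ≤ W.inverseImage E) (ι : 𝟭 C ⟶ E)
    {X G : C} (hX : ∀ Y : W.Localization, Subsingleton (W.Q.obj (E.obj X) ⟶ Y))
    (hG : Mono (W.Q.map (ι.app G))) : Subsingleton (W.Q.obj X ⟶ W.Q.obj G) := by
  have hE' : W.IsInvertedBy (E ⋙ W.Q) := fun _ _ f hf =>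
    Localization.inverts W.Q W _ (hE f hf)
  let E' := Localization.lift (E ⋙ W.Q) hE' W.Q
  let e : W.Q ⋙ E' ≅ E ⋙ W.Q := Localization.fac _ hE' W.Q
  let : Localization.Lifting W.Q W (𝟭 C ⋙ W.Q) (𝟭 W.Localization) := ⟨Iso.refl _⟩
  let : Localization.Lifting W.Q W (E ⋙ W.Q) E' := ⟨e⟩
  let τ : 𝟭 W.Localization ⟶ E' :=
    Localization.liftNatTrans W.Q W (𝟭 C ⋙ W.Q) (E ⋙ W.Q) _ _ (Functor.whiskerRight ι W.Q)
  have hτ : τ.app (W.Q.obj G) = W.Q.map (ι.app G) ≫ e.inv.app G := by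
    refine (Localization.liftNatTrans_app W.Q W _ _ _ _ _ _).trans ?_
    exact Category.id_comp _
  have : Mono (τ.app (W.Q.obj G)) := by
    rw [hτ]
    infer_instance
  refine ⟨fun f g => ?_⟩
  rw [← cancel_mono (τ.app (W.Q.obj G))]
  have h : E'.map f = E'.map g := by
    rw [← cancel_epi (e.inv.app X)]
    exact (hX _).elim _ _
  exact (τ.naturality f).trans ((congrArg _ h).trans (τ.naturality g).symm)

end Localization

/-! ### Vanishing of the reflection -/

section Reflection

open Opposite

variable {k : Type u} [Field k] (R : SCAlg k)

/-- The endofunctor `G ↦ (S ↦ colim G(S[Δ^•]))` of presheaves. -/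
def suslinPsh : Psh R ⥤ Psh R :=
  SimplicialObject.whiskering _ _ ⋙ (Functor.whiskeringLeft _ _ _).obj (simplexUnder R) ⋙
    (Functor.whiskeringRight _ _ _).obj (realization k)

lemma objectwiseQuasiIso_suslinPsh :
    objectwiseQuasiIso R ≤ (objectwiseQuasiIso R).inverseImage (suslinPsh R) :=
  fun _ _ _ hf S => quasiIso_realization_map _ fun m => hf (((simplexUnder R).obj S).obj m)

lemma underIncl_naturality {S T : Under R} (f : S ⟶ T) (m : SimplexCategoryᵒᵖ) :
    f ≫ underIncl R T m = underIncl R S m ≫ ((simplexUnder R).map f).app m := by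
  ext : 1
  exact (simplexIncl_naturality f.right m).symm

lemma underIncl_map (S : Under R) {m l : SimplexCategoryᵒᵖ} (α : m ⟶ l) :
    underIncl R S m ≫ ((simplexUnder R).obj S).map α = underIncl R S l := by
  ext : 1
  exact simplexIncl_map S.right α

/-- The canonical map from a presheaf to its localization. -/
def toSuslinPsh : 𝟭 (Psh R) ⟶ suslinPsh R where
  app G :=
    { app := fun S => G.map (underIncl R S (op (SimplexCategory.mk 0))) ≫
        zeroSimplices (((SimplicialObject.whiskering _ _).obj G).obj ((simplexUnder R).obj S))
      naturality := fun S T f => by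
        refine (G.map_comp_assoc _ _ _).symm.trans ?_
        rw [underIncl_naturality]
        refine (G.map_comp_assoc _ _ _).trans (Eq.trans ?_ (Category.assoc _ _ _).symm)
        exact congrArg _ (zeroSimplices_naturality
          (((SimplicialObject.whiskering _ _).obj G).map ((simplexUnder R).map f))) }
  naturality G H f := by
    ext S : 2
    refine (f.naturality_assoc _ _).symm.trans ?_
    refine Eq.trans ?_ (Category.assoc _ _ _).symm
    exact congrArg _ (zeroSimplices_naturality
      (((SimplicialObject.whiskering _ _).map f).app ((simplexUnder R).obj S)))

/-- The realization of the constant simplicial presheaf. -/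
abbrev constPsh (G : Psh R) : Psh R := G ⋙ SimplicialObject.const _ ⋙ realization k

variable {R}

/-- The maps `G(S) → G(S[Δᵐ])`. -/
def constToSimplex (G : Psh R) (S : Under R) : (SimplicialObject.const _).obj (G.obj S) ⟶
    ((SimplicialObject.whiskering _ _).obj G).obj ((simplexUnder R).obj S) where
  app m := G.map (underIncl R S m)
  naturality m l α := by
    refine (Category.id_comp _).trans ?_
    refine Eq.trans ?_ (G.map_comp _ _)
    rw [underIncl_map]

/-- The map to the localization of a presheaf from the realization of the constant simplicial
presheaf. -/
def constToSuslin (G : Psh R) : constPsh R G ⟶ (suslinPsh R).obj G where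
  app S := (realization k).map (constToSimplex G S)
  naturality S T f := by
    refine ((realization k).map_comp _ _).symm.trans
      (Eq.trans ?_ ((realization k).map_comp _ _))
    congr 1
    apply SimplicialObject.hom_ext
    intro m
    refine (G.map_comp _ _).symm.trans (Eq.trans ?_ (G.map_comp _ _))
    rw [underIncl_naturality]

/-- The retraction of the realization of the constant simplicial presheaf onto the presheaf. -/
def constPshRetraction (G : Psh R) : constPsh R G ⟶ G where
  app S := constRetraction (G.obj S)
  naturality _ _ f := constRetraction_naturality (G.map f)

/-- The inclusion of the zero simplices. -/
def toConstPsh (G : Psh R) : G ⟶ constPsh R G where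
  app S := zeroSimplices ((SimplicialObject.const _).obj (G.obj S))
  naturality _ _ f := zeroSimplices_naturality ((SimplicialObject.const _).map (G.map f))

/-- The map factors through the realization of the constant simplicial presheaf. The first factor is
a split mono, and the second is inverted because it is the realization of the levelwise
quasi-isomorphisms `G(S) → G(S[Δᵐ])`. -/
lemma mono_toHo_toSuslinPsh {G : Psh R} (hG : IsA1Invariant G) :
    Mono ((toHo R).map ((toSuslinPsh R).app G)) := by
  have h₁ : (toSuslinPsh R).app G = toConstPsh G ≫ constToSuslin G := by
    ext S : 2
    exact zeroSimplices_naturality (X := (SimplicialObject.const _).obj (G.obj S))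
      (Y := ((SimplicialObject.whiskering _ _).obj G).obj ((simplexUnder R).obj S))
      (constToSimplex G S)
  have h₂ : toConstPsh G ≫ constPshRetraction G = 𝟙 G := by
    ext S : 2
    exact zeroSimplices_constRetraction (G.obj S)
  have : IsIso ((toHo R).map (constToSuslin G)) :=
    Localization.inverts _ (objectwiseQuasiIso R) _ fun S =>
      quasiIso_realization_map _ fun m => quasiIso_map_underIncl hG S m
  have : Mono ((toHo R).map (toConstPsh G)) :=
    (SplitMono.mk ((toHo R).map (constPshRetraction G))
      (by rw [← Functor.map_comp, h₂]; exact (toHo R).map_id G)).mono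
  rw [h₁, Functor.map_comp]
  infer_instance

lemma subsingleton_hom_of_acyclic {F : Psh R} (hF : ∀ S, (F.obj S).Acyclic)
    (Y : (objectwiseQuasiIso R).Localization) : Subsingleton ((toHo R).obj F ⟶ Y) := by
  have : IsIso ((toHo R).map (0 : F ⟶ 0)) :=
    Localization.inverts _ (objectwiseQuasiIso R) _ fun S => by
      refine (quasiIso_iff _).mpr fun i => (quasiIsoAt_iff_exactAt _ _ (hF S i)).mpr ?_
      exact HomologicalComplex.ExactAt.of_isZero
        ((HomologicalComplex.eval _ _ i).map_isZero ((Limits.isZero_zero (Psh R)).obj S))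
  have := subsingleton_hom_of_isZero (W := objectwiseQuasiIso R)
    (Limits.isZero_zero (Psh R)) Y
  refine ⟨fun f g => ?_⟩
  rw [← cancel_epi (inv ((toHo R).map (0 : F ⟶ 0)))]
  exact Subsingleton.elim _ _

/-- An objectwise acyclic Suslin complex forces the `𝔸¹`-localization to vanish. -/
lemma isA1Localization_zero {F : Psh R} (hF : ∀ S, (((suslinPsh R).obj F).obj S).Acyclic) :
    IsA1Localization ((toHo R).map (0 : F ⟶ (Functor.const (Under R)).obj 0)) where
  invariant :=
    { weakEquivalence := fun _ _ _ _ => quasiIso_id _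
      affineLine := fun _ => quasiIso_id _ }
  universal G hG := by
    -- Both Hom sets have at most one element and contain the image of the zero map, so bijectivity
    -- is automatic.
    have h₁ : Subsingleton ((toHo R).obj F ⟶ (toHo R).obj G) :=
      subsingleton_hom_of_endofunctor (suslinPsh R) (objectwiseQuasiIso_suslinPsh R)
        (toSuslinPsh R) (subsingleton_hom_of_acyclic hF) (mono_toHo_toSuslinPsh hG)
    have h₂ : Subsingleton ((toHo R).obj ((Functor.const (Under R)).obj 0) ⟶ (toHo R).obj G) :=
      subsingleton_hom_of_isZero (W := objectwiseQuasiIso R)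
        (Functor.isZero _ fun _ => Limits.isZero_zero _) _
    exact ⟨fun _ _ _ => Subsingleton.elim _ _,
      fun _ => ⟨(toHo R).map 0, Subsingleton.elim _ _⟩⟩

end Reflection

end A1Loc

end

theorem mainTheorem6 (p : ℕ) [Fact p.Prime] (k : Type u) [Field k] [CharP k p]
    [PerfectField k] :
    (∀ S : A1Loc.SCAlg k,
      ((A1Loc.suslin k (A1Loc.derivedDeRham k)).obj S).Acyclic) ∧
    ∀ R : A1Loc.SCAlg k,
      A1Loc.IsA1Localization ((A1Loc.toHo R).map
        (0 : (Under.forget R ⋙ A1Loc.derivedDeRham k : A1Loc.Psh R) ⟶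
          (Functor.const (Under R)).obj 0)) :=
  -- The structure map from `R` plays no role in the values: the Suslin presheaf at an `R`-algebra
  -- `S` is definitionally the Suslin complex of `S.right`.
  ⟨A1Loc.acyclic_suslin_derivedDeRham p, fun _ =>
    A1Loc.isA1Localization_zero fun S => A1Loc.acyclic_suslin_derivedDeRham p S.right⟩
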